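/- **Definitions.** A *hypergraph* is a finite family $H$ of finite nonempty sets; its *carrier* is $\bigcup H$. It is *atomic* if $\{x\}\in H$ for every $x\in\bigcup H$, and *saturated* if $X_1\cup X_2\in H$ whenever $X_1,X_2\in H$ and $X_1\cap X_2\neq\emptyset$. A *hypergraph partition* of $H$ is a partition of $H$ whose parts have pairwise disjoint carriers; $H$ is *connected* if it has only one hypergraph partition. The *finest* hypergraph partition of $H$ is the one whose parts are all connected; its parts are the *connected components* of $H$, and their carriers are the connected components of $\bigcup H$. For $Y\subseteq\bigcup H$ put $H_Y=\{X\in H\mid X\subseteq Y\}$. A nonempty $Y\subseteq\bigcup H$ is *dispensable* in $H$ if $H_Y\setminus\{Y\}$ is a connected hypergraph with carrier $Y$. *Cognation* is the equivalence relation on hypergraphs generated by relating $H$ to $H\cup\{Y\}$ for $Y$ dispensable in $H$, and the *saturated closure* $\bar H$ is the greatest hypergraph cognate with $H$, i.e. the union of all hypergraphs cognate with $H$. *Constructions* of an atomic hypergraph $H$ are defined by induction on $|\bigcup H|$: (0) $\emptyset$ is the only construction of $\emptyset$; (1) if $H$ is nonempty and connected, $x\in\bigcup H$ and $K$ is a construction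 of $H_{\bigcup H\setminus\{x\}}$, then $K\cup\{\bigcup H\}$ is a construction of $H$; (2) if $H$ is not connected, with finest hypergraph partition $\{H_1,\dots,H_n\}$, and $K_i$ is a construction of $H_i$ for each $i$, then $K_1\cup\dots\cup K_n$ is a construction of $H$. A *construct* of $H$ is a subfamily of a construction of $H$ that contains every connected component of $\bigcup H$. The *abstract polytope* $\mathcal A(H)$ is the set of all constructs of $H$ together with the additional element $\bar H\cup\{*\}$, where $*$ is new, ordered by reverse inclusion. For $X\subseteq\bigcup H$ let $\pi_X=\{x\in\mathbb R^{\bigcup H}\mid\sum_{i\in X}x_i=3^{|X|}\}$ and $\pi_X^+=\{x\in\mathbb R^{\bigcup H}\mid\sum_{i\in X}x_i\ge 3^{|X|}\}$. If $H$ is nonempty, atomic, saturated and connected, put $$\mathcal G(H)=\bigcap\{\pi_X^+\mid X\in H\setminus\{\textstyle\bigcup H\}\}\cap\pi_{\bigcup H}.$$ For an arbitrary atomic hypergraph $H$, let $H_1,\dots,H_n$ be the connected components of $\bar H$ and put $\mathcal G(H)=\mathcal G(H_1)\times\dots\times\mathcal G(H_n)\subseteq\mathbb R^{\bigcup H}$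 (so $\mathcal G(\emptyset)=\mathbb R^0$ is a single point). This agrees with the displayed formula if $H$ is nonempty, atomic, saturated and connected. **Proposition 9.10.** For every atomic hypergraph $H$, the set $\mathcal G(H)$ is a convex polytope (the convex hull of finitely many points), and its face lattice (all its faces, including $\emptyset$ and $\mathcal G(H)$, ordered by inclusion) is isomorphic, as a partial order, to $\mathcal A(H)$. Moreover, $\mathcal G(H)$ is a simple polytope, i.e. every vertex figure of $\mathcal G(H)$ is a simplex (possibly empty), and there is a bijection $v\mapsto K_v$ from the vertices of $\mathcal G(H)$ to the constructions of $H$ such that, for every vertex $v$, $\{v\}=\bigcap\{\pi_X\mid X\in K_v\}$ (the intersection of the empty family being $\mathbb R^{\bigcup H}$) and $v\notin\pi_Y$ for every $Y\in\bar H\setminus K_v$. -/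

import Mathlib

namespace HGraph

section Combinatorics

variable {α : Type*} [DecidableEq α]

/-- The carrier `⋃ H` of a finite family `H` of finite sets. -/
def carrier (H : Finset (Finset α)) : Finset α := H.biUnion id

/-- A family of sets is a hypergraph (on its union) when the empty set is not a member. -/
def IsHypergraph (H : Finset (Finset α)) : Prop := ∅ ∉ H

/-- `H_Y`: the members of `H` that are included in `Y`. -/
def restrict (H : Finset (Finset α)) (Y : Finset α) : Finset (Finset α) :=
  H.filter (fun X => X ⊆ Y)

/-- Atomicity: every singleton of an element of the carrier is a member. -/
def IsAtomic (H : Finset (Finset α)) : Prop := ∀ x ∈ carrier H, {x} ∈ H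

/-- Saturation: the union of two members that meet is a member. -/
def IsSaturated (H : Finset (Finset α)) : Prop :=
  ∀ X ∈ H, ∀ Y ∈ H, (X ∩ Y).Nonempty → X ∪ Y ∈ H

/-- A hypergraph partition `{H₁, …, Hₙ}` of `H`: a partition of `H` (nonempty, pairwise disjoint
parts with union `H`) whose parts have pairwise disjoint carriers, so that
`⋃ H₁, …, ⋃ Hₙ` partition the carrier of `H`. -/
structure IsHypergraphPartition (H : Finset (Finset α))
    (P : Finset (Finset (Finset α))) : Prop where
  empty_notMem : ∅ ∉ P
  disjoint : ∀ J₁ ∈ P, ∀ J₂ ∈ P, J₁ ≠ J₂ → Disjoint J₁ J₂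
  biUnion_eq : P.biUnion id = H
  disjoint_carrier : ∀ J₁ ∈ P, ∀ J₂ ∈ P, J₁ ≠ J₂ → Disjoint (carrier J₁) (carrier J₂)

/-- `H` is connected when it has only one hypergraph partition. -/
def IsConnected (H : Finset (Finset α)) : Prop := ∃! P, IsHypergraphPartition H P

/-- The finest hypergraph partition: the one all of whose parts are connected. -/
def IsFinestPartition (H : Finset (Finset α)) (P : Finset (Finset (Finset α))) : Prop :=
  IsHypergraphPartition H P ∧ ∀ J ∈ P, IsConnected J

/-- `J` is a connected component of `H`. -/
def IsComponent (H J : Finset (Finset α)) : Prop := ∃ P, IsFinestPartition H P ∧ J ∈ P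

/-- `IsConstruction H K`: the family `K` is a construction of the (atomic) hypergraph `H`. -/
inductive IsConstruction : Finset (Finset α) → Finset (Finset α) → Prop
  | empty : IsConstruction ∅ ∅
  | connected (H K : Finset (Finset α)) (x : α) (hH : IsConnected H) (hx : x ∈ carrier H)
      (hK : IsConstruction (restrict H (carrier H \ {x})) K) :
      IsConstruction H (insert (carrier H) K)
  | disconnected (H : Finset (Finset α)) (P : Finset (Finset (Finset α)))
      (K : Finset (Finset α) → Finset (Finset α)) (hcard : 2 ≤ (carrier H).card)
      (hH : ¬ IsConnected H) (hP : IsFinestPartition H P)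
      (hK : ∀ J ∈ P, IsConstruction J (K J)) :
      IsConstruction H (P.biUnion K)

/-- A construct of `H`: a subfamily of a construction of `H` that contains every connected
component of the carrier of `H`. -/
def IsConstruct (H C : Finset (Finset α)) : Prop :=
  (∃ K, IsConstruction H K ∧ C ⊆ K) ∧ ∀ J, IsComponent H J → carrier J ∈ C

/-- `Y ⊆ ⋃ H` is dispensable in `H` when `H_Y \ {Y}` is a connected hypergraph on `Y`. -/
def IsDispensable (H : Finset (Finset α)) (Y : Finset α) : Prop :=
  Y ⊆ carrier H ∧ IsHypergraph ((restrict H Y).erase Y) ∧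
    carrier ((restrict H Y).erase Y) = Y ∧ IsConnected ((restrict H Y).erase Y)

/-- The hypergraph `J` enhances the hypergraph `H`: it is `H ∪ {Y}` with `Y` dispensable in `H`
and not already a member of `H`. -/
def Enhances (J H : Finset (Finset α)) : Prop :=
  IsHypergraph H ∧ IsHypergraph J ∧ ∃ Y, IsDispensable H Y ∧ Y ∉ H ∧ J = insert Y H

/-- Cognation: the equivalence relation generated by enhancement. -/
def Cognate : Finset (Finset α) → Finset (Finset α) → Prop := Relation.EqvGen Enhances

open Classical in
/-- The saturated closure of `H`: the greatest hypergraph in its cognate set, i.e. the union of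
all the hypergraphs that are cognate with `H` (they all have the same carrier). -/
noncomputable def satClosure (H : Finset (Finset α)) : Finset (Finset α) :=
  (carrier H).powerset.filter (fun Y => ∃ J, Cognate H J ∧ Y ∈ J)

/-- The faces of the abstract polytope of `H`, as finite sets over `Option (Finset α)`, where
`none` is the additional element `*`: the constructs of `H`, and the saturated closure of `H`
together with `*`. -/
def abstractFaces (H : Finset (Finset α)) : Set (Finset (Option (Finset α))) :=
  {F | (∃ C, IsConstruct H C ∧ F = C.map Function.Embedding.some) ∨
    F = Finset.insertNone (satClosure H)}

/-- The abstract polytope of `H`: its faces ordered by reverse inclusion. -/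
abbrev AbstractPolytope (H : Finset (Finset α)) : Type _ := (abstractFaces H)ᵒᵈ

theorem carrier_satClosure (H : Finset (Finset α)) : carrier (satClosure H) = carrier H := by
  classical
  apply Finset.Subset.antisymm
  · refine Finset.biUnion_subset.2 fun X hX => ?_
    exact (Finset.mem_powerset.1 (Finset.mem_filter.1 hX).1 :)
  · refine Finset.biUnion_subset.2 fun X hX => Finset.subset_biUnion_of_mem id ?_
    exact Finset.mem_filter.2 ⟨Finset.mem_powerset.2 (Finset.subset_biUnion_of_mem id hX),
      H, Relation.EqvGen.refl H, hX⟩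

theorem IsComponent.carrier_subset {H J : Finset (Finset α)} (h : IsComponent H J) :
    carrier J ⊆ carrier H := by
  obtain ⟨P, hP, hJ⟩ := h
  refine Finset.biUnion_subset_biUnion_of_subset_left id ?_
  rw [← hP.1.biUnion_eq]
  exact Finset.subset_biUnion_of_mem id hJ

theorem IsComponent.mem_carrier {H J : Finset (Finset α)} (h : IsComponent (satClosure H) J)
    {i : α} (hi : i ∈ carrier J) : i ∈ carrier H :=
  carrier_satClosure H ▸ h.carrier_subset hi

end Combinatorics

section Realization

variable {α : Type*} [DecidableEq α]

/-- The space `ℝ^(⋃ H)`. -/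
abbrev Space (H : Finset (Finset α)) : Type _ := {i // i ∈ carrier H} → ℝ

/-- The hyperplane `π_X : ∑_{i ∈ X} x_i = 3 ^ |X|` in `ℝ^(⋃ H)`, for `X ⊆ ⋃ H`. -/
def hyperplane (H : Finset (Finset α)) (X : Finset α) : Set (Space H) :=
  {x | ∑ i : {i // i ∈ carrier H} with i.1 ∈ X, x i = (3 : ℝ) ^ X.card}

/-- The closed halfspace `π_X⁺ : ∑_{i ∈ X} x_i ≥ 3 ^ |X|` in `ℝ^(⋃ H)`, for `X ⊆ ⋃ H`. -/
def halfspace (H : Finset (Finset α)) (X : Finset α) : Set (Space H) :=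
  {x | ∑ i : {i // i ∈ carrier H} with i.1 ∈ X, x i ≥ (3 : ℝ) ^ X.card}

/-- The intersection of the halfspaces `π_X⁺`, for `X` in `H \ {⋃ H}`, with the hyperplane of
`⋃ H`; this is the realization of a nonempty atomic, saturated and connected `H`. -/
def ascPolytope (H : Finset (Finset α)) : Set (Space H) :=
  (⋂ X ∈ H.erase (carrier H), halfspace H X) ∩ hyperplane H (carrier H)

/-- The realization of an atomic hypergraph `H`: the product of the realizations of the connected
components `J` of the saturated closure of `H`. Since the carriers of the components partition
`⋃ H`, the product of the spaces `ℝ^(⋃ J)` is `ℝ^(⋃ H)`, a point of which lies in the product when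
each of its restrictions to `⋃ J` lies in the realization of `J`. For the empty hypergraph this is
the whole of `ℝ^∅`, which is a single point. -/
def polytope (H : Finset (Finset α)) : Set (Space H) :=
  {x | ∀ (J : Finset (Finset α)) (hJ : IsComponent (satClosure H) J),
    (fun i : {i // i ∈ carrier J} => x ⟨i, hJ.mem_carrier i.2⟩) ∈ ascPolytope J}

end Realization

section ConvexPolytopes

variable {E : Type*} [AddCommGroup E] [Module ℝ E] [TopologicalSpace E]

/-- A convex polytope is the convex hull of finitely many points. -/
def IsConvexPolytope (P : Set E) : Prop := ∃ s : Set E, s.Finite ∧ P = convexHull ℝ s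

/-- The faces of `P`: the empty set, and the sets of points of `P` at which some linear functional
attains its maximum over `P`. As a type, they are ordered by inclusion. -/
def faces (P : Set E) : Set (Set E) := {F | IsExposed ℝ P F}

/-- `v` is a vertex of `P` when `{v}` is a face of `P`. -/
def IsVertex (P : Set E) (v : E) : Prop := {v} ∈ faces P

/-- A simplex is the convex hull of finitely many affinely independent points (the empty simplex
is allowed). -/
def IsSimplex (Q : Set E) : Prop :=
  ∃ (n : ℕ) (p : Fin n → E), AffineIndependent ℝ p ∧ Q = convexHull ℝ (Set.range p)

/-- A vertex figure of `P` at the vertex `v`: the section of `P` by a hyperplane that strictly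
separates `v` from all the other vertices of `P`. -/
def IsVertexFigure (P : Set E) (v : E) (Q : Set E) : Prop :=
  ∃ (l : StrongDual ℝ E) (c : ℝ), c < l v ∧ (∀ w, IsVertex P w → w ≠ v → l w < c) ∧
    Q = {x ∈ P | l x = c}

/-- A simple polytope: all the vertex figures are simplices. -/
def IsSimplePolytope (P : Set E) : Prop :=
  IsConvexPolytope P ∧ ∀ v, IsVertex P v → ∀ Q, IsVertexFigure P v Q → IsSimplex Q

end ConvexPolytopes

end HGraph

/-! Let B be the saturated closure of H. A nonempty Y is in B exactly when `restrict H Y` is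
connected (`mem_satClosure`). Constructs turn out to be the nested families: subfamilies of B that
contain the maximal members of B and in which a union of members lies in B only if it is one of the
members united (`isConstruct_iff_isNested`).

The polytope is the polyhedron with one inequality for each member of B and one equation for each
maximal member (`polytope_eq`). The right-hand sides grow so fast that 3^|X| + 3^|Y| < 3^|X ∪ Y| for
incomparable X and Y. Hence a union of tight sets that is not one of them has too small a sum to lie
in B, so the tight sets at a point of the polytope are nested (`carrier_mem_or_sum_lt`). Conversely,
every nested family is exactly the family of tight sets of some point (`IsNested.exists_point`).

The rest is polyhedral geometry. Nonempty faces are determined by the constraints tight on them, so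
they correspond to nested families with inclusion reversed (`nonempty_faces_orderIso`). The
equations of a construction have at most one solution, so constructions are the tight families of
vertices. Deleting a nonmaximal member from a construction leaves a nested family. Each such
deletion gives a way out of the vertex, and these directions span the simplicial vertex figure
(`isSimplex_of_isVertexFigure`). -/

namespace HGraph

/-! ### Connectivity, the saturated closure and connected components -/

section Combinatorics

theorem IsHypergraph.nonempty {α : Type*} {H : Finset (Finset α)} (hH : IsHypergraph H)
    {X : Finset α} (hX : X ∈ H) : X.Nonempty :=
  Finset.nonempty_iff_ne_empty.2 fun h => hH (h ▸ hX)

theorem IsHypergraph.mono {α : Type*} {H J : Finset (Finset α)} (hH : IsHypergraph H) (h : J ⊆ H) :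
    IsHypergraph J := fun h' => hH (h h')

variable {α : Type*} [DecidableEq α]

theorem mem_carrier {H : Finset (Finset α)} {x : α} : x ∈ carrier H ↔ ∃ X ∈ H, x ∈ X := by
  simp [carrier]

theorem subset_carrier {H : Finset (Finset α)} {X : Finset α} (hX : X ∈ H) : X ⊆ carrier H :=
  Finset.subset_biUnion_of_mem id hX

theorem carrier_subset_iff {H : Finset (Finset α)} {Y : Finset α} :
    carrier H ⊆ Y ↔ ∀ X ∈ H, X ⊆ Y := Finset.biUnion_subset

theorem carrier_mono {H J : Finset (Finset α)} (h : H ⊆ J) : carrier H ⊆ carrier J :=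
  Finset.biUnion_subset_biUnion_of_subset_left id h

theorem mem_restrict {H : Finset (Finset α)} {X Y : Finset α} :
    X ∈ restrict H Y ↔ X ∈ H ∧ X ⊆ Y := Finset.mem_filter

theorem restrict_subset (H : Finset (Finset α)) (Y : Finset α) : restrict H Y ⊆ H :=
  Finset.filter_subset _ _

theorem restrict_restrict (H : Finset (Finset α)) {Y Z : Finset α} (h : Y ⊆ Z) :
    restrict (restrict H Z) Y = restrict H Y := by
  ext X
  simp only [mem_restrict]
  exact ⟨fun hX => ⟨hX.1.1, hX.2⟩, fun hX => ⟨⟨hX.1, hX.2.trans h⟩, hX.2⟩⟩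

theorem restrict_carrier (H : Finset (Finset α)) : restrict H (carrier H) = H := by
  ext X
  simp only [mem_restrict]
  exact ⟨fun h => h.1, fun h => ⟨h, subset_carrier h⟩⟩

theorem IsAtomic.carrier_restrict {H : Finset (Finset α)} (hA : IsAtomic H) {Y : Finset α}
    (hY : Y ⊆ carrier H) : carrier (restrict H Y) = Y := by
  apply Finset.Subset.antisymm
  · exact carrier_subset_iff.2 fun X hX => (mem_restrict.1 hX).2
  · intro x hx
    exact mem_carrier.2 ⟨{x}, mem_restrict.2 ⟨hA x (hY hx), by simpa using hx⟩, by simp⟩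

theorem IsAtomic.restrict {H : Finset (Finset α)} (hA : IsAtomic H) (Y : Finset α) :
    IsAtomic (restrict H Y) := by
  intro x hx
  obtain ⟨X, hX, hxX⟩ := mem_carrier.1 hx
  rw [mem_restrict] at hX ⊢
  exact ⟨hA x (subset_carrier hX.1 hxX), by simpa using hX.2 hxX⟩

/-- No set separates the members of `H` into two nontrivial classes. -/
def IsUncut (H : Finset (Finset α)) : Prop :=
  ∀ S : Finset α, (∀ X ∈ H, X ⊆ S ∨ Disjoint X S) → carrier H ⊆ S ∨ Disjoint (carrier H) S

theorem isHypergraphPartition_trivial {H : Finset (Finset α)} (hne : H.Nonempty) :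
    IsHypergraphPartition H {H} where
  empty_notMem := by simpa using hne.ne_empty.symm
  disjoint := by simp +contextual
  biUnion_eq := by simp
  disjoint_carrier := by simp +contextual

theorem IsHypergraphPartition.mem_iff {H : Finset (Finset α)} {P : Finset (Finset (Finset α))}
    (hP : IsHypergraphPartition H P) {X : Finset α} : X ∈ H ↔ ∃ J ∈ P, X ∈ J := by
  rw [← hP.biUnion_eq]; simp

theorem IsHypergraphPartition.subset {H : Finset (Finset α)} {P : Finset (Finset (Finset α))}
    (hP : IsHypergraphPartition H P) {J : Finset (Finset α)} (hJ : J ∈ P) : J ⊆ H :=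
  fun _ hX => hP.mem_iff.2 ⟨J, hJ, hX⟩

theorem IsHypergraphPartition.carrier_nonempty {H : Finset (Finset α)}
    {P : Finset (Finset (Finset α))} (hP : IsHypergraphPartition H P) (hH : IsHypergraph H)
    {J : Finset (Finset α)} (hJ : J ∈ P) : (carrier J).Nonempty := by
  have hne : J.Nonempty := Finset.nonempty_iff_ne_empty.2 fun h => hP.empty_notMem (h ▸ hJ)
  obtain ⟨X, hX⟩ := hne
  exact (hH.nonempty (hP.subset hJ hX)).mono (subset_carrier hX)

theorem IsHypergraphPartition.subset_or_disjoint {H : Finset (Finset α)}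
    {P : Finset (Finset (Finset α))} (hP : IsHypergraphPartition H P)
    {J : Finset (Finset α)} (hJ : J ∈ P) {X : Finset α} (hX : X ∈ H) :
    X ⊆ carrier J ∨ Disjoint X (carrier J) := by
  obtain ⟨J', hJ', hXJ'⟩ := hP.mem_iff.1 hX
  by_cases h : J' = J
  · exact Or.inl (h ▸ subset_carrier hXJ')
  · exact Or.inr ((hP.disjoint_carrier J' hJ' J hJ h).mono_left (subset_carrier hXJ'))

/-- A set that cuts no member but separates the carrier sorts the members into two parts with
disjoint carriers. Conversely, the carrier of any part is such a set. Nonempty members are needed so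
that distinct parts have distinct nonempty carriers. -/
theorem isConnected_iff_isUncut {H : Finset (Finset α)} (hH : IsHypergraph H) :
    IsConnected H ↔ IsUncut H := by
  constructor
  · rintro ⟨P, hP, huniq⟩ S hS
    by_contra! hcon
    obtain ⟨h1, h2⟩ := hcon
    have hne : H.Nonempty := by
      by_contra h
      rw [Finset.not_nonempty_iff_eq_empty] at h
      subst h
      simp [carrier] at h1
    have hex1 : ∃ X ∈ H, ¬ X ⊆ S := by
      by_contra! h
      exact h1 (carrier_subset_iff.2 h)
    have hex2 : ∃ X ∈ H, X ⊆ S := by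
      by_contra! h
      refine h2 ((Finset.disjoint_biUnion_left _ _ _).2 fun X hX => ?_)
      exact (hS X hX).resolve_left (h X hX)
    have hpart : IsHypergraphPartition H {H.filter (· ⊆ S), H.filter (¬ · ⊆ S)} := by
      have hd : Disjoint (H.filter (· ⊆ S)) (H.filter (¬ · ⊆ S)) :=
        Finset.disjoint_filter_filter_not _ _ _
      have hc : Disjoint (carrier (H.filter (· ⊆ S))) (carrier (H.filter (¬ · ⊆ S))) := by
        have h1 : carrier (H.filter (· ⊆ S)) ⊆ S :=
          carrier_subset_iff.2 fun X hX => (Finset.mem_filter.1 hX).2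
        refine Disjoint.mono_left h1 ?_
        refine ((Finset.disjoint_biUnion_left _ _ _).2 fun X hX => ?_).symm
        rw [Finset.mem_filter] at hX
        exact (hS X hX.1).resolve_left hX.2
      refine ⟨?_, ?_, ?_, ?_⟩
      · simp only [Finset.mem_insert, Finset.mem_singleton, not_or]
        obtain ⟨X, hX⟩ := hex1
        obtain ⟨Y, hY⟩ := hex2
        exact ⟨(Finset.ne_empty_of_mem (Finset.mem_filter.2 hY)).symm,
          (Finset.ne_empty_of_mem (Finset.mem_filter.2 hX)).symm⟩
      · simp only [Finset.mem_insert, Finset.mem_singleton]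
        rintro J₁ (rfl | rfl) J₂ (rfl | rfl) h
        exacts [absurd rfl h, hd, hd.symm, absurd rfl h]
      · simp [Finset.filter_union_filter_not_eq]
      · simp only [Finset.mem_insert, Finset.mem_singleton]
        rintro J₁ (rfl | rfl) J₂ (rfl | rfl) h
        exacts [absurd rfl h, hc, hc.symm, absurd rfl h]
    have heq := (huniq _ hpart).trans (huniq _ (isHypergraphPartition_trivial hne)).symm
    have hmem : H.filter (· ⊆ S) ∈ ({H} : Finset (Finset (Finset α))) := by
      rw [← heq]; simp
    rw [Finset.mem_singleton, Finset.filter_eq_self] at hmem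
    obtain ⟨X, hX, hXS⟩ := hex1
    exact hXS (hmem X hX)
  · intro hU
    rcases H.eq_empty_or_nonempty with rfl | hne
    · refine ⟨∅, ⟨by simp, by simp, by simp, by simp⟩, fun P hP => ?_⟩
      rw [Finset.eq_empty_iff_forall_notMem]
      intro J hJ
      have := hP.subset hJ
      rw [Finset.subset_empty] at this
      exact hP.empty_notMem (this ▸ hJ)
    · refine ⟨{H}, isHypergraphPartition_trivial hne, fun P hP => ?_⟩
      have key : ∀ J ∈ P, J = H := by
        intro J hJ
        refine Finset.Subset.antisymm (hP.subset hJ) fun X hX => ?_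
        obtain ⟨J', hJ', hXJ'⟩ := hP.mem_iff.1 hX
        by_cases h : J' = J
        · exact h ▸ hXJ'
        exfalso
        rcases hU (carrier J) fun X hX => hP.subset_or_disjoint hJ hX with h1 | h1
        · have h2 := hP.disjoint_carrier J' hJ' J hJ h
          exact (hP.carrier_nonempty hH hJ').ne_empty
            (disjoint_self.1 (h2.mono_right ((carrier_mono (hP.subset hJ')).trans h1)))
        · exact (hP.carrier_nonempty hH hJ).ne_empty
            (disjoint_self.1 (h1.mono_left (carrier_mono (hP.subset hJ))))
      obtain ⟨X, hX⟩ := hne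
      obtain ⟨J, hJ, -⟩ := hP.mem_iff.1 hX
      ext J'
      rw [Finset.mem_singleton]
      exact ⟨key J', fun h => h ▸ key J hJ ▸ hJ⟩

/-- Cognate hypergraphs have the same carriers and the same connectivity of restrictions. -/
def SameConnectivity (J H : Finset (Finset α)) : Prop :=
  (IsHypergraph J ↔ IsHypergraph H) ∧
    ∀ Y, carrier (restrict J Y) = carrier (restrict H Y) ∧
      (IsUncut (restrict J Y) ↔ IsUncut (restrict H Y))

theorem Enhances.sameConnectivity {J H : Finset (Finset α)} (h : Enhances J H) :
    SameConnectivity J H := by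
  obtain ⟨hH, hJ, Z, ⟨-, hZh, hZc, hZconn⟩, hZH, rfl⟩ := h
  rw [isConnected_iff_isUncut hZh] at hZconn
  refine ⟨iff_of_true hJ hH, fun Y => ?_⟩
  by_cases hZY : Z ⊆ Y
  · have hr : restrict (insert Z H) Y = insert Z (restrict H Y) := by
      simp [restrict, Finset.filter_insert, hZY]
    have hsub : (restrict H Z).erase Z ⊆ restrict H Y := fun X hX => by
      have := mem_restrict.1 (Finset.mem_of_mem_erase hX)
      exact mem_restrict.2 ⟨this.1, this.2.trans hZY⟩
    have hc : carrier (restrict (insert Z H) Y) = carrier (restrict H Y) := by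
      rw [hr]
      have : Z ⊆ carrier (restrict H Y) := by
        conv_lhs => rw [← hZc]
        exact carrier_mono hsub
      rw [carrier, Finset.biUnion_insert]
      exact Finset.union_eq_right.2 this
    refine ⟨hc, ?_⟩
    unfold IsUncut
    refine forall_congr' fun S => ?_
    rw [hc, hr, Finset.forall_mem_insert]
    -- The new member `Z` adds no condition: a set that cuts no member properly inside `Z` cannot
    -- cut `Z`, because those members are connected with carrier `Z`.
    refine imp_congr_left ⟨fun h => h.2, fun h => ⟨?_, h⟩⟩
    have := hZconn S fun X hX => h X (hsub hX)
    rwa [hZc] at this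
  · have hr : restrict (insert Z H) Y = restrict H Y := by
      simp [restrict, Finset.filter_insert, hZY]
    rw [hr]
    exact ⟨rfl, Iff.rfl⟩

theorem Cognate.sameConnectivity {J H : Finset (Finset α)} (h : Cognate J H) :
    SameConnectivity J H := by
  induction h with
  | rel J H h => exact h.sameConnectivity
  | refl H => exact ⟨Iff.rfl, fun Y => ⟨rfl, Iff.rfl⟩⟩
  | symm J H _ ih => exact ⟨ih.1.symm, fun Y => ⟨(ih.2 Y).1.symm, (ih.2 Y).2.symm⟩⟩
  | trans I J H _ _ ih₁ ih₂ =>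
    exact ⟨ih₁.1.trans ih₂.1, fun Y => ⟨(ih₁.2 Y).1.trans (ih₂.2 Y).1,
      (ih₁.2 Y).2.trans (ih₂.2 Y).2⟩⟩

theorem isUncut_restrict_self {H : Finset (Finset α)} {Y : Finset α} (hY : Y ∈ H) :
    IsUncut (restrict H Y) := by
  have hc : carrier (restrict H Y) = Y :=
    Finset.Subset.antisymm (carrier_subset_iff.2 fun X hX => (mem_restrict.1 hX).2)
      (subset_carrier (mem_restrict.2 ⟨hY, Finset.Subset.refl Y⟩))
  intro S hS
  rw [hc]
  exact hS Y (mem_restrict.2 ⟨hY, Finset.Subset.refl Y⟩)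

/-- If Y is a member of a cognate J, then J restricted to Y is trivially connected, and cognation
preserves connectivity of restrictions. Conversely, a Y outside H with connected restriction is
dispensable, so adjoining it stays in the cognation class. -/
theorem mem_satClosure {H : Finset (Finset α)} (hH : IsHypergraph H) (hA : IsAtomic H)
    {Y : Finset α} :
    Y ∈ satClosure H ↔ Y ⊆ carrier H ∧ Y.Nonempty ∧ IsUncut (restrict H Y) := by
  classical
  rw [satClosure, Finset.mem_filter, Finset.mem_powerset]
  refine and_congr_right fun hY => ⟨?_, ?_⟩
  · rintro ⟨J, hHJ, hYJ⟩
    have hsc := hHJ.sameConnectivity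
    exact ⟨(hsc.1.1 hH).nonempty hYJ, (hsc.2 Y).2.2 (isUncut_restrict_self hYJ)⟩
  · rintro ⟨hne, hu⟩
    by_cases hYH : Y ∈ H
    · exact ⟨H, .refl H, hYH⟩
    · refine ⟨insert Y H, .symm _ _ (.rel _ _ ⟨hH, ?_, Y, ⟨hY, ?_⟩, hYH, rfl⟩),
        Finset.mem_insert_self _ _⟩
      · intro h
        rcases Finset.mem_insert.1 h with h | h
        · exact hne.ne_empty h.symm
        · exact hH h
      · have hr : (restrict H Y).erase Y = restrict H Y :=
          Finset.erase_eq_of_notMem fun h => hYH (mem_restrict.1 h).1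
        have hh : IsHypergraph (restrict H Y) := hH.mono (restrict_subset _ _)
        rw [hr]
        exact ⟨hh, hA.carrier_restrict hY, (isConnected_iff_isUncut hh).2 hu⟩

theorem subset_satClosure (H : Finset (Finset α)) : H ⊆ satClosure H := by
  classical
  exact fun X hX => Finset.mem_filter.2 ⟨Finset.mem_powerset.2 (subset_carrier hX), H, .refl H, hX⟩

theorem isHypergraph_satClosure {H : Finset (Finset α)} (hH : IsHypergraph H) (hA : IsAtomic H) :
    IsHypergraph (satClosure H) := fun h => by
  simpa using ((mem_satClosure hH hA).1 h).2.1

theorem isAtomic_satClosure {H : Finset (Finset α)} (hA : IsAtomic H) :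
    IsAtomic (satClosure H) := fun x hx =>
  subset_satClosure H (hA x (carrier_satClosure H ▸ hx))

theorem isSaturated_satClosure {H : Finset (Finset α)} (hH : IsHypergraph H) (hA : IsAtomic H) :
    IsSaturated (satClosure H) := by
  intro X hX Y hY hXY
  rw [mem_satClosure hH hA] at hX hY ⊢
  refine ⟨Finset.union_subset hX.1 hY.1, hX.2.1.mono Finset.subset_union_left, fun S hS => ?_⟩
  have hXS := hX.2.2 S fun Z hZ => hS Z (by
    rw [mem_restrict] at hZ ⊢
    exact ⟨hZ.1, hZ.2.trans Finset.subset_union_left⟩)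
  have hYS := hY.2.2 S fun Z hZ => hS Z (by
    rw [mem_restrict] at hZ ⊢
    exact ⟨hZ.1, hZ.2.trans Finset.subset_union_right⟩)
  rw [hA.carrier_restrict (Finset.union_subset hX.1 hY.1)]
  rw [hA.carrier_restrict hX.1] at hXS
  rw [hA.carrier_restrict hY.1] at hYS
  obtain ⟨z, hz⟩ := hXY
  rw [Finset.mem_inter] at hz
  rcases hXS with hXS | hXS <;> rcases hYS with hYS | hYS
  · exact Or.inl (Finset.union_subset hXS hYS)
  · exact absurd (hXS hz.1) (Finset.disjoint_left.1 hYS hz.2)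
  · exact absurd (hYS hz.2) (Finset.disjoint_left.1 hXS hz.1)
  · exact Or.inr (Finset.disjoint_union_left.2 ⟨hXS, hYS⟩)

/-- Inside a connected Y take a largest member Z through a chosen point. By saturation any member
inside Y that meets Z is absorbed by Z, so Z cuts nothing and must be Y. -/
theorem IsSaturated.satClosure_eq {H : Finset (Finset α)} (hS : IsSaturated H)
    (hH : IsHypergraph H) (hA : IsAtomic H) : satClosure H = H := by
  refine Finset.Subset.antisymm (fun Y hY => ?_) (subset_satClosure H)
  rw [mem_satClosure hH hA] at hY
  obtain ⟨hYc, ⟨y, hy⟩, hu⟩ := hY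
  obtain ⟨Z, hZ, hmax⟩ := Finset.exists_max_image ((restrict H Y).filter (y ∈ ·)) Finset.card
    ⟨{y}, by simpa [mem_restrict, hy] using hA y (hYc hy)⟩
  rw [Finset.mem_filter, mem_restrict] at hZ
  obtain ⟨⟨hZH, hZY⟩, hyZ⟩ := hZ
  have hcut : ∀ X ∈ restrict H Y, X ⊆ Z ∨ Disjoint X Z := by
    intro X hX
    rw [or_iff_not_imp_right, Finset.not_disjoint_iff_nonempty_inter]
    intro hXZ
    rw [mem_restrict] at hX
    have hle := hmax (X ∪ Z) (by
      rw [Finset.mem_filter, mem_restrict]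
      exact ⟨⟨hS X hX.1 Z hZH hXZ, Finset.union_subset hX.2 hZY⟩,
        Finset.mem_union_right _ hyZ⟩)
    rw [Finset.eq_of_subset_of_card_le Finset.subset_union_right hle]
    exact Finset.subset_union_left
  rcases hu Z hcut with h | h
  · rw [hA.carrier_restrict hYc] at h
    exact Finset.Subset.antisymm h hZY ▸ hZH
  · rw [hA.carrier_restrict hYc] at h
    exact absurd hyZ (Finset.disjoint_left.1 h hy)

/-- Membership of Y in the closure depends only on the members of H inside Y. This lets the
inductions on constructions pass to restrictions. -/
theorem satClosure_restrict {H : Finset (Finset α)} (hH : IsHypergraph H) (hA : IsAtomic H)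
    {Z : Finset α} (hZ : Z ⊆ carrier H) :
    satClosure (restrict H Z) = restrict (satClosure H) Z := by
  ext Y
  rw [mem_restrict, mem_satClosure hH hA,
    mem_satClosure (hH.mono (restrict_subset _ _)) (hA.restrict Z), hA.carrier_restrict hZ]
  constructor
  · rintro ⟨h1, h2, h3⟩
    rw [restrict_restrict H h1] at h3
    exact ⟨⟨h1.trans hZ, h2, h3⟩, h1⟩
  · rintro ⟨⟨-, h2, h3⟩, h1⟩
    refine ⟨h1, h2, ?_⟩
    rwa [restrict_restrict H h1]

/-- The inclusion-maximal members of a family. -/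
def maximalMembers (B : Finset (Finset α)) : Finset (Finset α) :=
  B.filter fun M => ∀ Y ∈ B, M ⊆ Y → Y ⊆ M

theorem mem_maximalMembers {B : Finset (Finset α)} {M : Finset α} :
    M ∈ maximalMembers B ↔ M ∈ B ∧ ∀ Y ∈ B, M ⊆ Y → Y ⊆ M := Finset.mem_filter

theorem exists_subset_maximalMembers {B : Finset (Finset α)} {X : Finset α} (hX : X ∈ B) :
    ∃ M ∈ maximalMembers B, X ⊆ M := by
  obtain ⟨M, hM, hmax⟩ := Finset.exists_max_image (B.filter (X ⊆ ·)) Finset.card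
    ⟨X, by simpa using hX⟩
  rw [Finset.mem_filter] at hM
  refine ⟨M, mem_maximalMembers.2 ⟨hM.1, fun Y hY hMY => ?_⟩, hM.2⟩
  exact (Finset.eq_of_subset_of_card_le hMY
    (hmax Y (Finset.mem_filter.2 ⟨hY, hM.2.trans hMY⟩))).ge

theorem IsSaturated.subset_of_mem_maximalMembers {B : Finset (Finset α)} (hS : IsSaturated B)
    {M X : Finset α} (hM : M ∈ maximalMembers B) (hX : X ∈ B) (h : (X ∩ M).Nonempty) : X ⊆ M := by
  rw [mem_maximalMembers] at hM
  exact Finset.subset_union_left.trans (hM.2 _ (hS X hX M hM.1 h) Finset.subset_union_right)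

theorem isComponent_iff {H : Finset (Finset α)} (hH : IsHypergraph H) (hA : IsAtomic H)
    {J : Finset (Finset α)} :
    IsComponent H J ↔ ∃ M ∈ maximalMembers (satClosure H), J = restrict H M := by
  have hSat := isSaturated_satClosure hH hA
  constructor
  · rintro ⟨P, ⟨hP, hconn⟩, hJ⟩
    have hJH := hP.subset hJ
    have hr : J = restrict H (carrier J) := by
      ext X
      rw [mem_restrict]
      refine ⟨fun hX => ⟨hJH hX, subset_carrier hX⟩, fun ⟨hX, hXJ⟩ => ?_⟩
      obtain ⟨J', hJ', hXJ'⟩ := hP.mem_iff.1 hX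
      by_cases h : J' = J
      · exact h ▸ hXJ'
      · have := (hP.disjoint_carrier J' hJ' J hJ h).mono (subset_carrier hXJ') hXJ
        exact absurd (disjoint_self.1 this) (hH.nonempty hX).ne_empty
    refine ⟨carrier J, mem_maximalMembers.2 ⟨?_, fun Y hY hJY => ?_⟩, hr⟩
    · rw [mem_satClosure hH hA, ← hr]
      exact ⟨carrier_mono hJH, hP.carrier_nonempty hH hJ,
        (isConnected_iff_isUncut (hH.mono hJH)).1 (hconn J hJ)⟩
    -- A part's carrier cuts no member, so a connected `Y` containing it cannot be larger.
    · rw [mem_satClosure hH hA] at hY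
      rcases hY.2.2 (carrier J) fun X hX => hP.subset_or_disjoint hJ (mem_restrict.1 hX).1
        with h | h
      · rwa [hA.carrier_restrict hY.1] at h
      · rw [hA.carrier_restrict hY.1] at h
        exact absurd (disjoint_self.1 (h.mono_left hJY)) (hP.carrier_nonempty hH hJ).ne_empty
  · rintro ⟨M, hM, rfl⟩
    have hB : ∀ M ∈ maximalMembers (satClosure H), M ⊆ carrier H ∧ M.Nonempty ∧
        IsUncut (restrict H M) := fun M hM =>
      (mem_satClosure hH hA).1 (mem_maximalMembers.1 hM).1
    have hdisj : ∀ M₁ ∈ maximalMembers (satClosure H), ∀ M₂ ∈ maximalMembers (satClosure H),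
        restrict H M₁ ≠ restrict H M₂ → Disjoint M₁ M₂ := by
      intro M₁ h₁ M₂ h₂ hne
      by_contra hnd
      rw [Finset.not_disjoint_iff_nonempty_inter] at hnd
      refine hne (congrArg _ (Finset.Subset.antisymm ?_ ?_))
      · exact hSat.subset_of_mem_maximalMembers h₂ (mem_maximalMembers.1 h₁).1 hnd
      · exact hSat.subset_of_mem_maximalMembers h₁ (mem_maximalMembers.1 h₂).1
          (by rwa [Finset.inter_comm])
    have hdisj' : ∀ M₁ ∈ maximalMembers (satClosure H), ∀ M₂ ∈ maximalMembers (satClosure H),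
        restrict H M₁ ≠ restrict H M₂ →
          Disjoint (carrier (restrict H M₁)) (carrier (restrict H M₂)) := by
      intro M₁ h₁ M₂ h₂ hne
      rw [hA.carrier_restrict (hB M₁ h₁).1, hA.carrier_restrict (hB M₂ h₂).1]
      exact hdisj M₁ h₁ M₂ h₂ hne
    refine ⟨(maximalMembers (satClosure H)).image (restrict H), ⟨⟨?_, ?_, ?_, ?_⟩, ?_⟩,
      Finset.mem_image_of_mem _ hM⟩
    · intro h
      obtain ⟨M, hM, he⟩ := Finset.mem_image.1 h
      have := hA.carrier_restrict (hB M hM).1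
      rw [he] at this
      exact (hB M hM).2.1.ne_empty (this.symm.trans (by simp [carrier]))
    · simp only [Finset.forall_mem_image]
      intro M₁ h₁ M₂ h₂ hne
      rw [Finset.disjoint_left]
      intro X hX₁ hX₂
      rw [mem_restrict] at hX₁ hX₂
      exact (hH.nonempty hX₁.1).ne_empty
        (disjoint_self.1 ((hdisj M₁ h₁ M₂ h₂ hne).mono hX₁.2 hX₂.2))
    · ext X
      simp only [Finset.mem_biUnion, Finset.mem_image, id, exists_exists_and_eq_and, mem_restrict]
      constructor
      · rintro ⟨M, -, hX, -⟩
        exact hX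
      · intro hX
        obtain ⟨M, hM, hXM⟩ := exists_subset_maximalMembers (subset_satClosure H hX)
        exact ⟨M, hM, hX, hXM⟩
    · simp only [Finset.forall_mem_image]
      exact hdisj'
    · simp only [Finset.forall_mem_image]
      intro M hM
      exact (isConnected_iff_isUncut (hH.mono (restrict_subset _ _))).2 (hB M hM).2.2

end Combinatorics


/-! ### Constructs as nested families -/

section Combinatorics

variable {α : Type*} [DecidableEq α]

/-- Nested families in a family `B`: they contain the maximal members of `B`, and none of their
subfamilies has a union in `B` except trivially. -/
structure IsNested (B N : Finset (Finset α)) : Prop where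
  subset : N ⊆ B
  maximalMembers_subset : maximalMembers B ⊆ N
  carrier_mem : ∀ S ⊆ N, carrier S ∈ B → carrier S ∈ S

theorem IsNested.mono {B N N' : Finset (Finset α)} (hN : IsNested B N) (h : N' ⊆ N)
    (hM : maximalMembers B ⊆ N') : IsNested B N' :=
  ⟨h.trans hN.subset, hM, fun S hS => hN.carrier_mem S (hS.trans h)⟩

theorem carrier_mem_satClosure {H : Finset (Finset α)} (hH : IsHypergraph H) (hA : IsAtomic H)
    (hc : IsConnected H) (hne : (carrier H).Nonempty) : carrier H ∈ satClosure H :=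
  (mem_satClosure hH hA).2 ⟨Finset.Subset.refl _, hne,
    (restrict_carrier H).symm ▸ (isConnected_iff_isUncut hH).1 hc⟩

theorem subset_carrier_of_mem_satClosure {H : Finset (Finset α)} {X : Finset α}
    (hX : X ∈ satClosure H) : X ⊆ carrier H :=
  carrier_satClosure H ▸ subset_carrier hX

theorem maximalMembers_satClosure_of_isConnected {H : Finset (Finset α)} (hH : IsHypergraph H)
    (hA : IsAtomic H) (hc : IsConnected H) (hne : (carrier H).Nonempty) :
    maximalMembers (satClosure H) = {carrier H} := by
  have hC := carrier_mem_satClosure hH hA hc hne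
  ext M
  rw [Finset.mem_singleton, mem_maximalMembers]
  constructor
  · rintro ⟨hM, hmax⟩
    have h := subset_carrier_of_mem_satClosure hM
    exact Finset.Subset.antisymm h (hmax _ hC h)
  · rintro rfl
    exact ⟨hC, fun Y hY _ => subset_carrier_of_mem_satClosure hY⟩

theorem IsFinestPartition.exists_eq_restrict {H : Finset (Finset α)}
    {P : Finset (Finset (Finset α))} (hP : IsFinestPartition H P) (hH : IsHypergraph H)
    (hA : IsAtomic H) {J : Finset (Finset α)} (hJ : J ∈ P) :
    ∃ M ∈ maximalMembers (satClosure H), J = restrict H M :=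
  (isComponent_iff hH hA).1 ⟨P, hP, hJ⟩

theorem maximalMembers_satClosure_eq {H : Finset (Finset α)} (hH : IsHypergraph H)
    (hA : IsAtomic H) {M M' : Finset α} (hM : M ∈ maximalMembers (satClosure H))
    (hM' : M' ∈ maximalMembers (satClosure H)) (h : (M ∩ M').Nonempty) : M = M' := by
  have hS := isSaturated_satClosure hH hA
  exact Finset.Subset.antisymm
    (hS.subset_of_mem_maximalMembers hM' (mem_maximalMembers.1 hM).1 h)
    (hS.subset_of_mem_maximalMembers hM (mem_maximalMembers.1 hM').1 (by rwa [Finset.inter_comm]))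

theorem IsFinestPartition.exists_restrict_mem {H : Finset (Finset α)}
    {P : Finset (Finset (Finset α))} (hP : IsFinestPartition H P) (hH : IsHypergraph H)
    (hA : IsAtomic H) {Y : Finset α} (hY : Y ∈ satClosure H) :
    ∃ M ∈ maximalMembers (satClosure H), restrict H M ∈ P ∧ Y ⊆ M := by
  obtain ⟨M, hM, hYM⟩ := exists_subset_maximalMembers hY
  obtain ⟨y, hy⟩ := (isHypergraph_satClosure hH hA).nonempty hY
  obtain ⟨J, hJ, hyJ⟩ := hP.1.mem_iff.1 (hA y (subset_carrier_of_mem_satClosure hY hy))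
  obtain ⟨M', hM', rfl⟩ := hP.exists_eq_restrict hH hA hJ
  have hyM' : y ∈ M' := by simpa using (mem_restrict.1 hyJ).2
  rw [← maximalMembers_satClosure_eq hH hA hM hM' ⟨y, Finset.mem_inter.2 ⟨hYM hy, hyM'⟩⟩] at hJ
  exact ⟨M, hM, hJ, hYM⟩

theorem subset_carrier_of_mem_maximalMembers {H : Finset (Finset α)} {M : Finset α}
    (hM : M ∈ maximalMembers (satClosure H)) : M ⊆ carrier H :=
  subset_carrier_of_mem_satClosure (mem_maximalMembers.1 hM).1

theorem IsConstruction.isNested {H K : Finset (Finset α)} (h : IsConstruction H K)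
    (hH : IsHypergraph H) (hA : IsAtomic H) : IsNested (satClosure H) K := by
  induction h with
  | empty =>
    have h0 : satClosure (∅ : Finset (Finset α)) = ∅ := by
      rw [Finset.eq_empty_iff_forall_notMem]
      intro Y hY
      have h1 := subset_carrier_of_mem_satClosure hY
      have h2 := (isHypergraph_satClosure hH hA).nonempty hY
      obtain ⟨y, hy⟩ := h2
      simpa [carrier] using h1 hy
    rw [h0]
    exact ⟨by simp, by simp [maximalMembers], by simp⟩
  | connected H K x hc hx hK ih =>
    have hsub : carrier H \ {x} ⊆ carrier H := Finset.sdiff_subset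
    have ih := ih (hH.mono (restrict_subset _ _)) (hA.restrict _)
    rw [satClosure_restrict hH hA hsub] at ih
    refine ⟨?_, ?_, fun S hS hSB => ?_⟩
    · rw [Finset.insert_subset_iff]
      exact ⟨carrier_mem_satClosure hH hA hc ⟨x, hx⟩, ih.subset.trans (restrict_subset _ _)⟩
    · rw [maximalMembers_satClosure_of_isConnected hH hA hc ⟨x, hx⟩]
      simp
    · by_cases hCS : carrier H ∈ S
      · rwa [Finset.Subset.antisymm (subset_carrier_of_mem_satClosure hSB) (subset_carrier hCS)]
      -- Without the whole carrier, every set of `S` avoids `x`, so the union already lies in the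
      -- closure of the restriction.
      · have hSK : S ⊆ K := (Finset.subset_insert_iff_of_notMem hCS).1 hS
        refine ih.carrier_mem S hSK (mem_restrict.2 ⟨hSB, carrier_subset_iff.2 fun X hX => ?_⟩)
        exact (mem_restrict.1 (ih.subset (hSK hX))).2
  | disconnected H P K hcard hc hP hK ih =>
    have ih' : ∀ M ∈ maximalMembers (satClosure H), restrict H M ∈ P →
        IsNested (restrict (satClosure H) M) (K (restrict H M)) := by
      intro M hM hMP
      have := ih _ hMP (hH.mono (restrict_subset _ _)) (hA.restrict _)
      rwa [satClosure_restrict hH hA (subset_carrier_of_mem_maximalMembers hM)] at this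
    have hKmem : ∀ X ∈ P.biUnion K, ∃ M ∈ maximalMembers (satClosure H), restrict H M ∈ P ∧
        X ∈ K (restrict H M) ∧ X ∈ satClosure H ∧ X ⊆ M := by
      intro X hX
      obtain ⟨J, hJ, hXJ⟩ := Finset.mem_biUnion.1 hX
      obtain ⟨M, hM, rfl⟩ := hP.exists_eq_restrict hH hA hJ
      exact ⟨M, hM, hJ, hXJ, mem_restrict.1 ((ih' M hM hJ).subset hXJ)⟩
    refine ⟨fun X hX => ?_, fun M hM => ?_, fun S hS hSB => ?_⟩
    · obtain ⟨M, -, -, -, hX, -⟩ := hKmem X hX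
      exact hX
    · have hM' := mem_maximalMembers.1 hM
      obtain ⟨M', hM'', hMP, hsub⟩ := hP.exists_restrict_mem hH hA hM'.1
      have heq : M = M' :=
        Finset.Subset.antisymm hsub (hM'.2 _ (mem_maximalMembers.1 hM'').1 hsub)
      subst heq
      refine Finset.mem_biUnion.2 ⟨_, hMP, (ih' M hM hMP).maximalMembers_subset ?_⟩
      exact mem_maximalMembers.2 ⟨mem_restrict.2 ⟨hM'.1, Finset.Subset.refl _⟩,
        fun Y hY _ => (mem_restrict.1 hY).2⟩
    -- A union lying in the closure is connected, hence inside one component, and all of `S` comes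
    -- from that component's construction.
    · obtain ⟨M, hM, hMP, hSM⟩ := hP.exists_restrict_mem hH hA hSB
      refine (ih' M hM hMP).carrier_mem S (fun X hX => ?_) (mem_restrict.2 ⟨hSB, hSM⟩)
      obtain ⟨M', hM', -, hXK, hXB, hXM'⟩ := hKmem X (hS hX)
      have hXM := (subset_carrier hX).trans hSM
      obtain ⟨y, hy⟩ := (isHypergraph_satClosure hH hA).nonempty hXB
      rwa [maximalMembers_satClosure_eq hH hA hM hM'
        ⟨y, Finset.mem_inter.2 ⟨hXM hy, hXM' hy⟩⟩]

theorem two_le_card_carrier_of_not_isConnected {H : Finset (Finset α)} (hH : IsHypergraph H)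
    (hc : ¬ IsConnected H) : 2 ≤ (carrier H).card := by
  by_contra! hlt
  refine hc ((isConnected_iff_isUncut hH).2 fun S _ => or_iff_not_imp_left.2 fun hS => ?_)
  obtain ⟨a, ha, haS⟩ := Finset.not_subset.1 hS
  rw [Finset.disjoint_left]
  intro b hb
  rwa [Finset.card_le_one.1 (by omega) b hb a ha]

/-- Induction on the size of the carrier. In the connected case the members other than the carrier
cannot cover it, so some vertex is left to remove. In the disconnected case the components are
treated separately. -/
theorem IsNested.exists_isConstruction {H N : Finset (Finset α)} (hN : IsNested (satClosure H) N)
    (hH : IsHypergraph H) (hA : IsAtomic H) : ∃ K, IsConstruction H K ∧ N ⊆ K := by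
  induction hn : (carrier H).card using Nat.strong_induction_on generalizing H N with
  | _ n ih =>
  subst hn
  have hBH := isHypergraph_satClosure hH hA
  rcases H.eq_empty_or_nonempty with rfl | ⟨X₀, hX₀⟩
  · refine ⟨∅, .empty, fun X hX => ?_⟩
    obtain ⟨y, hy⟩ := hBH.nonempty (hN.subset hX)
    simpa [carrier] using subset_carrier_of_mem_satClosure (hN.subset hX) hy
  have hCne : (carrier H).Nonempty := (hH.nonempty hX₀).mono (subset_carrier hX₀)
  by_cases hc : IsConnected H
  · have hCB := carrier_mem_satClosure hH hA hc hCne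
    have hex : ∃ x ∈ carrier H, x ∉ carrier (N.erase (carrier H)) := by
      by_contra! hcon
      have heq : carrier (N.erase (carrier H)) = carrier H :=
        Finset.Subset.antisymm (carrier_subset_iff.2 fun X hX =>
          subset_carrier_of_mem_satClosure (hN.subset (Finset.mem_of_mem_erase hX))) hcon
      have := hN.carrier_mem _ (Finset.erase_subset _ _) (heq.symm ▸ hCB)
      rw [heq] at this
      simp at this
    obtain ⟨x, hx, hxN⟩ := hex
    have hsub : carrier H \ {x} ⊆ carrier H := Finset.sdiff_subset
    -- Removing `x` may create components missing from `N`, so their carriers are adjoined. A union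
    -- lying in one of them, `M`, either uses `M` and equals it, or uses only old members of `N`.
    have hN' : IsNested (satClosure (restrict H (carrier H \ {x})))
        (N.erase (carrier H) ∪
          maximalMembers (satClosure (restrict H (carrier H \ {x})))) := by
      rw [satClosure_restrict hH hA hsub]
      refine ⟨?_, Finset.subset_union_right, fun S hS hSB => ?_⟩
      · refine Finset.union_subset (fun X hX => ?_) (Finset.filter_subset _ _)
        have hXB := hN.subset (Finset.mem_of_mem_erase hX)
        refine mem_restrict.2 ⟨hXB, fun y hy => ?_⟩
        rw [Finset.mem_sdiff, Finset.mem_singleton]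
        refine ⟨subset_carrier_of_mem_satClosure hXB hy, ?_⟩
        rintro rfl
        exact hxN (subset_carrier hX hy)
      · obtain ⟨M, hM, hSM⟩ := exists_subset_maximalMembers hSB
        by_cases hMS : M ∈ S
        · rwa [Finset.Subset.antisymm hSM (subset_carrier hMS)]
        · refine hN.carrier_mem S (fun X hX => ?_) (mem_restrict.1 hSB).1
          rcases Finset.mem_union.1 (hS hX) with h | h
          · exact Finset.mem_of_mem_erase h
          · have hXM := (subset_carrier hX).trans hSM
            have := (mem_maximalMembers.1 h).2 M (mem_maximalMembers.1 hM).1 hXM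
            exact absurd (Finset.Subset.antisymm hXM this ▸ hX) hMS
    obtain ⟨K, hK, hNK⟩ := ih _ (by
      rw [hA.carrier_restrict hsub]
      exact Finset.card_lt_card (Finset.sdiff_ssubset (by simpa using hx) (by simp))) hN'
      (hH.mono (restrict_subset _ _)) (hA.restrict _) rfl
    refine ⟨insert (carrier H) K, .connected H K x hc hx hK, ?_⟩
    rw [Finset.subset_insert_iff]
    exact Finset.subset_union_left.trans hNK
  · obtain ⟨y, hy⟩ := hCne
    obtain ⟨M₀, hM₀, -⟩ := exists_subset_maximalMembers (subset_satClosure H (hA y hy))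
    obtain ⟨P, hP, -⟩ := (isComponent_iff hH hA).2 ⟨M₀, hM₀, rfl⟩
    have hex : ∀ J ∈ P, ∃ K, IsConstruction J K ∧ restrict N (carrier J) ⊆ K := by
      intro J hJ
      obtain ⟨M, hM, rfl⟩ := hP.exists_eq_restrict hH hA hJ
      have hMC := subset_carrier_of_mem_maximalMembers hM
      have hMne : M ≠ carrier H := by
        rintro rfl
        refine hc ?_
        have := hP.2 _ hJ
        rwa [restrict_carrier] at this
      rw [hA.carrier_restrict hMC]
      refine ih _ ?_ ?_ (hH.mono (restrict_subset _ _)) (hA.restrict _) rfl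
      · rw [hA.carrier_restrict hMC]
        exact Finset.card_lt_card (Finset.ssubset_iff_subset_ne.2 ⟨hMC, hMne⟩)
      · rw [satClosure_restrict hH hA hMC]
        refine ⟨fun X hX => ?_, fun X hX => ?_, fun S hS hSB => ?_⟩
        · rw [mem_restrict] at hX ⊢
          exact ⟨hN.subset hX.1, hX.2⟩
        · obtain ⟨h1, h2⟩ := mem_maximalMembers.1 hX
          have hM1 : M ∈ restrict (satClosure H) M :=
            mem_restrict.2 ⟨(mem_maximalMembers.1 hM).1, Finset.Subset.refl _⟩
          have hXM := (mem_restrict.1 h1).2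
          rw [Finset.Subset.antisymm hXM (h2 M hM1 hXM)]
          exact mem_restrict.2 ⟨hN.maximalMembers_subset hM, Finset.Subset.refl _⟩
        · exact hN.carrier_mem S (hS.trans (restrict_subset _ _)) (mem_restrict.1 hSB).1
    choose! K hK hNK using hex
    refine ⟨P.biUnion K, .disconnected H P K (two_le_card_carrier_of_not_isConnected hH hc) hc hP
      hK, fun X hX => ?_⟩
    obtain ⟨M, hM, hMP, hXM⟩ := hP.exists_restrict_mem hH hA (hN.subset hX)
    refine Finset.mem_biUnion.2 ⟨_, hMP, hNK _ hMP (mem_restrict.2 ⟨hX, ?_⟩)⟩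
    rwa [hA.carrier_restrict (subset_carrier_of_mem_maximalMembers hM)]

theorem isConstruct_iff_isNested {H C : Finset (Finset α)} (hH : IsHypergraph H)
    (hA : IsAtomic H) : IsConstruct H C ↔ IsNested (satClosure H) C := by
  have hcomp : (∀ J, IsComponent H J → carrier J ∈ C) ↔ maximalMembers (satClosure H) ⊆ C := by
    simp only [isComponent_iff hH hA]
    constructor
    · intro h M hM
      have := h _ ⟨M, hM, rfl⟩
      rwa [hA.carrier_restrict (subset_carrier_of_mem_maximalMembers hM)] at this
    · rintro h _ ⟨M, hM, rfl⟩
      rw [hA.carrier_restrict (subset_carrier_of_mem_maximalMembers hM)]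
      exact h hM
  rw [IsConstruct, hcomp]
  constructor
  · rintro ⟨⟨K, hK, hCK⟩, hM⟩
    exact (hK.isNested hH hA).mono hCK hM
  · intro h
    exact ⟨h.exists_isConstruction hH hA, h.maximalMembers_subset⟩

/-- The equations are triangular: in the connected case the coordinate at the removed vertex is
recovered from the total once the other coordinates are known to vanish. -/
theorem IsConstruction.eq_zero {H K : Finset (Finset α)} (h : IsConstruction H K)
    (hA : IsAtomic H) {d : α → ℝ} (hd : ∀ X ∈ K, ∑ i ∈ X, d i = 0) : ∀ i ∈ carrier H, d i = 0 := by
  induction h with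
  | empty => simp [carrier]
  | connected H K x hc hx hK ih =>
    have ih := ih (hA.restrict _) fun X hX => hd X (Finset.mem_insert_of_mem hX)
    rw [hA.carrier_restrict Finset.sdiff_subset] at ih
    intro i hi
    by_cases hix : i = x
    · subst hix
      rw [← hd _ (Finset.mem_insert_self _ _)]
      refine (Finset.sum_eq_single_of_mem i hi fun j hj hji => ih j ?_).symm
      simp [hj, hji]
    · exact ih i (by simp [hi, hix])
  | disconnected H P K hcard hc hP hK ih =>
    intro i hi
    obtain ⟨J, hJ, hiJ⟩ := hP.1.mem_iff.1 (hA i hi)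
    have hi' : i ∈ carrier J := subset_carrier hiJ (Finset.mem_singleton_self i)
    refine ih J hJ ?_ (fun X hX => hd X (Finset.mem_biUnion.2 ⟨J, hJ, hX⟩)) i hi'
    -- Atomicity of the part: the singleton of `j` lies in some part, and disjointness of carriers
    -- forces it to be this one.
    intro j hj
    obtain ⟨J', hJ', hjJ'⟩ := hP.1.mem_iff.1 (hA j (carrier_mono (hP.1.subset hJ) hj))
    by_cases hJJ : J' = J
    · exact hJJ ▸ hjJ'
    · exact absurd hj (Finset.disjoint_left.1 (hP.1.disjoint_carrier J' hJ' J hJ hJJ)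
        (subset_carrier hjJ' (Finset.mem_singleton_self j)))

end Combinatorics


/-! ### Estimates with powers of 3 and points with prescribed tight sets -/

section Points

theorem two_mul_pow_card_lt {α : Type*} {X Y : Finset α} (h : X ⊂ Y) :
    2 * (3 : ℝ) ^ X.card < 3 ^ Y.card := by
  have h1 : (3 : ℝ) ^ (X.card + 1) ≤ 3 ^ Y.card :=
    pow_le_pow_right₀ (by norm_num) (Finset.card_lt_card h)
  have h2 : (0 : ℝ) < 3 ^ X.card := by positivity
  rw [pow_succ] at h1
  linarith

variable {α : Type*} [DecidableEq α]

theorem sum_union_le {x : α → ℝ} {X Y : Finset α} (hx : ∀ i ∈ X, 0 ≤ x i) :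
    ∑ i ∈ X ∪ Y, x i ≤ ∑ i ∈ X, x i + ∑ i ∈ Y, x i := by
  rw [← Finset.sum_union_inter]
  have : 0 ≤ ∑ i ∈ X ∩ Y, x i :=
    Finset.sum_nonneg fun i hi => hx i (Finset.mem_inter.1 hi).1
  linarith

/-- Adjoin the sets one at a time. If neither the new set nor the union so far contains the other,
both are proper in the new union, so each bound is less than half of the new one, and their sum
stays strictly below it. -/
theorem carrier_mem_or_sum_lt {x : α → ℝ} {S : Finset (Finset α)} (hx : ∀ i ∈ carrier S, 0 ≤ x i)
    (hS : ∀ X ∈ S, ∑ i ∈ X, x i ≤ 3 ^ X.card) :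
    carrier S ∈ S ∨ ∑ i ∈ carrier S, x i < 3 ^ (carrier S).card := by
  induction S using Finset.induction_on with
  | empty => right; simp [carrier]
  | insert X S hXS ih =>
    have hc : carrier (insert X S) = X ∪ carrier S := Finset.biUnion_insert
    rw [hc] at hx ⊢
    have ih := ih (fun i hi => hx i (Finset.mem_union_right _ hi))
      (fun Y hY => hS Y (Finset.mem_insert_of_mem hY))
    have hX := hS X (Finset.mem_insert_self _ _)
    by_cases h1 : X ⊆ carrier S
    · rw [Finset.union_eq_right.2 h1]
      exact ih.imp_left Finset.mem_insert_of_mem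
    by_cases h2 : carrier S ⊆ X
    · rw [Finset.union_eq_left.2 h2]
      exact Or.inl (Finset.mem_insert_self _ _)
    right
    have hle : ∑ i ∈ carrier S, x i ≤ 3 ^ (carrier S).card := by
      rcases ih with h | h
      · exact hS _ (Finset.mem_insert_of_mem h)
      · exact h.le
    have h3 : X ⊂ X ∪ carrier S :=
      Finset.ssubset_iff_subset_ne.2
        ⟨Finset.subset_union_left, fun h => h2 (Finset.left_eq_union.1 h)⟩
    have h4 : carrier S ⊂ X ∪ carrier S :=
      Finset.ssubset_iff_subset_ne.2
        ⟨Finset.subset_union_right, fun h => h1 (Finset.right_eq_union.1 h)⟩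
    have h5 := sum_union_le (Y := carrier S) fun i hi => hx i (Finset.mem_union_left _ hi)
    have h6 := two_mul_pow_card_lt h3
    have h7 := two_mul_pow_card_lt h4
    linarith

theorem sum_carrier_le {x : α → ℝ} {S : Finset (Finset α)} (hx : ∀ i ∈ carrier S, 0 ≤ x i)
    (hS : ∀ X ∈ S, ∑ i ∈ X, x i ≤ 3 ^ X.card) :
    ∑ i ∈ carrier S, x i ≤ 3 ^ (carrier S).card :=
  (carrier_mem_or_sum_lt hx hS).elim (fun h => hS _ h) le_of_lt

/-- The elements of `X` that lie in no smaller member of `N`. -/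
def ownElements (N : Finset (Finset α)) (X : Finset α) : Finset α :=
  X \ carrier (N.filter (· ⊂ X))

theorem carrier_filter_ssubset_subset (N : Finset (Finset α)) (X : Finset α) :
    carrier (N.filter (· ⊂ X)) ⊆ X :=
  carrier_subset_iff.2 fun _ hZ => (Finset.mem_filter.1 hZ).2.1

theorem ownElements_nonempty {N : Finset (Finset α)}
    (hN : ∀ S ⊆ N, carrier S ∈ N → carrier S ∈ S) {X : Finset α} (hX : X ∈ N) :
    (ownElements N X).Nonempty := by
  rw [ownElements, Finset.sdiff_nonempty]
  intro h
  have heq := Finset.Subset.antisymm h (carrier_filter_ssubset_subset N X)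
  have := hN _ (Finset.filter_subset (· ⊂ X) N) (heq ▸ hX)
  rw [← heq, Finset.mem_filter] at this
  exact this.2.2 (Finset.Subset.refl _)

theorem sum_ownElements (N : Finset (Finset α)) (X : Finset α) (x : α → ℝ) :
    ∑ i ∈ ownElements N X, x i + ∑ i ∈ carrier (N.filter (· ⊂ X)), x i = ∑ i ∈ X, x i :=
  Finset.sum_sdiff (carrier_filter_ssubset_subset N X)

/-- The point is built by adjoining members of increasing size: the elements not covered by smaller
members share equally what is missing from the required sum. -/
theorem exists_tight_point (N : Finset (Finset α)) (hN : ∀ S ⊆ N, carrier S ∈ N → carrier S ∈ S)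
    (hlam : ∀ X ∈ N, ∀ Y ∈ N, X ⊆ Y ∨ Y ⊆ X ∨ Disjoint X Y) :
    ∃ x : α → ℝ, (∀ i, 0 < x i) ∧ ∀ X ∈ N, ∑ i ∈ X, x i = 3 ^ X.card ∧
      ∀ i ∈ ownElements N X, ∀ j ∈ ownElements N X, x i = x j := by
  induction hn : N.card generalizing N with
  | zero =>
    rw [Finset.card_eq_zero] at hn
    subst hn
    exact ⟨fun _ => 1, by simp, by simp⟩
  | succ n ih =>
    -- A member of largest size lies in no other member, so changing the coordinates at its own
    -- elements disturbs no other equation.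
    obtain ⟨X, hX, hmax⟩ := Finset.exists_max_image N Finset.card
      (Finset.card_pos.1 (by omega))
    have herase : N.erase X ⊆ N := Finset.erase_subset _ _
    obtain ⟨x', hpos, hx'⟩ := ih (N.erase X)
      (fun S hS hSN => hN S (hS.trans herase) (herase hSN))
      (fun Y hY Z hZ => hlam Y (herase hY) Z (herase hZ))
      (by rw [Finset.card_erase_of_mem hX]; omega)
    set R := ownElements N X with hR
    set U := carrier (N.filter (· ⊂ X)) with hU
    have hRne : R.Nonempty := ownElements_nonempty hN hX
    have hr : (0 : ℝ) < R.card := by exact_mod_cast hRne.card_pos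
    have hUX : U ⊂ X := by
      refine Finset.ssubset_iff_subset_ne.2 ⟨carrier_filter_ssubset_subset N X, fun h => ?_⟩
      rw [hR, ownElements, ← hU, h] at hRne
      simp at hRne
    have hUle : ∑ i ∈ U, x' i ≤ 3 ^ U.card := by
      refine sum_carrier_le (fun i _ => (hpos i).le) fun Z hZ => ?_
      rw [Finset.mem_filter] at hZ
      exact (hx' Z (Finset.mem_erase.2 ⟨hZ.2.ne, hZ.1⟩)).1.le
    have hUlt : ∑ i ∈ U, x' i < 3 ^ X.card := by
      have h1 := two_mul_pow_card_lt hUX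
      have h2 : (0 : ℝ) < 3 ^ U.card := by positivity
      linarith
    have hout : ∀ Z ∈ N.erase X, ∀ i ∈ Z, i ∉ R := by
      intro Z hZ i hi hiR
      have hZX := Finset.ne_of_mem_erase hZ
      rw [hR, ownElements, Finset.mem_sdiff] at hiR
      rcases hlam Z (herase hZ) X hX with h | h | h
      · exact hiR.2 (mem_carrier.2
          ⟨Z, Finset.mem_filter.2 ⟨herase hZ, Finset.ssubset_iff_subset_ne.2 ⟨h, hZX⟩⟩, hi⟩)
      · exact hZX (Finset.eq_of_subset_of_card_le h (hmax Z (herase hZ))).symm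
      · exact Finset.disjoint_left.1 h hi hiR.1
    have hfilter : ∀ Z ∈ N.erase X, ownElements (N.erase X) Z = ownElements N Z := by
      intro Z hZ
      rw [ownElements, ownElements, Finset.filter_erase, Finset.erase_eq_of_notMem]
      rw [Finset.mem_filter]
      rintro ⟨-, h⟩
      exact absurd (hmax Z (herase hZ)) (not_le.2 (Finset.card_lt_card h))
    -- The common value that makes the sum over `X` exact. It is positive because the sum over `U`
    -- is at most 3^|U| < 3^|X|.
    set c := (3 ^ X.card - ∑ i ∈ U, x' i) / R.card with hc
    have hcpos : 0 < c := div_pos (by linarith) hr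
    refine ⟨fun i => if i ∈ R then c else x' i, fun i => ?_, fun Z hZN => ?_⟩
    · dsimp only
      split_ifs
      exacts [hcpos, hpos i]
    · by_cases hZX : Z = X
      · subst hZX
        constructor
        · rw [← sum_ownElements N, ← hR, ← hU]
          have h1 : ∑ i ∈ R, (if i ∈ R then c else x' i) = R.card * c := by
            rw [Finset.sum_congr rfl fun i hi => if_pos hi]
            simp
          have h2 : ∑ i ∈ U, (if i ∈ R then c else x' i) = ∑ i ∈ U, x' i := by
            refine Finset.sum_congr rfl fun i hi => if_neg fun hiR => ?_
            rw [hR, ownElements, Finset.mem_sdiff] at hiR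
            exact hiR.2 hi
          rw [h1, h2, hc]
          field_simp
          ring
        · intro i hi j hj
          simp only [← hR] at hi hj
          simp [hi, hj]
      · have hZ : Z ∈ N.erase X := Finset.mem_erase.2 ⟨hZX, hZN⟩
        constructor
        · rw [Finset.sum_congr rfl fun i hi => if_neg (hout Z hZ i hi)]
          exact (hx' Z hZ).1
        · intro i hi j hj
          dsimp only
          rw [if_neg (hout Z hZ i (Finset.mem_sdiff.1 hi).1),
            if_neg (hout Z hZ j (Finset.mem_sdiff.1 hj).1)]
          rw [← hfilter Z hZ] at hi hj
          exact (hx' Z hZ).2 i hi j hj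

/-- The numerical core of `IsNested.exists_point`: X has k covered and r own elements, each own
element having coordinate c, and Y ⊂ X has m elements, s of them among the own elements. These s
coordinates alone exceed 3^m. -/
theorem pow_lt_mul_of_le {k r s m : ℕ} {c : ℝ} (hs : 1 ≤ s) (hsr : s ≤ r) (hm : m + r ≤ k + r + s)
    (hmn : m < k + r) (hc : (3 : ℝ) ^ (k + r) - 3 ^ k ≤ r * c) : (3 : ℝ) ^ m < s * c := by
  have hs' : (1 : ℝ) ≤ s := by exact_mod_cast hs
  have hr' : (0 : ℝ) < r := by exact_mod_cast (by omega : 0 < r)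
  have hK : (0 : ℝ) < 3 ^ k := by positivity
  suffices h : r * (3 : ℝ) ^ m < s * (3 ^ (k + r) - 3 ^ k) by
    have h1 : (s : ℝ) * (3 ^ (k + r) - 3 ^ k) ≤ s * (r * c) :=
      mul_le_mul_of_nonneg_left hc (by positivity)
    have h2 : r * (3 : ℝ) ^ m < r * (s * c) := by linarith
    exact lt_of_mul_lt_mul_left h2 hr'.le
  rcases Nat.exists_eq_add_of_le hsr with ⟨d, rfl⟩
  rcases Nat.eq_zero_or_pos d with rfl | hd
  · simp only [add_zero] at *
    have h1 : (3 : ℝ) ^ (m + 1) ≤ 3 ^ (k + s) := pow_le_pow_right₀ (by norm_num) hmn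
    have h2 : (3 : ℝ) ^ (k + 1) ≤ 3 ^ (k + s) := pow_le_pow_right₀ (by norm_num) (by omega)
    rw [pow_succ] at h1 h2
    exact mul_lt_mul_of_pos_left (by linarith) hr'
  · have h1 : (3 : ℝ) ^ m ≤ 3 ^ (k + s) := pow_le_pow_right₀ (by norm_num) (by omega)
    have hA : (1 : ℝ) < 3 ^ s := one_lt_pow₀ (by norm_num) (by omega)
    -- Bernoulli's inequality for 3 = 1 + 2. The term 2d leaves one d to absorb the factor s + d and
    -- another to absorb the -1.
    have hD : (1 : ℝ) + d * 2 ≤ 3 ^ d := by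
      have := one_add_mul_le_pow (a := (2 : ℝ)) (by norm_num) d
      norm_num at this
      exact this
    have hd' : (1 : ℝ) ≤ d := by exact_mod_cast hd
    set A : ℝ := 3 ^ s
    have hkey : (s + d) * A < s * (A * 3 ^ d - 1) := by
      have e1 : s * (A * (1 + d * 2)) ≤ s * (A * 3 ^ d) := by gcongr
      have e2 : 1 * (A * d) ≤ s * (A * d) := by gcongr
      have e3 : s * (1 * 1) < s * (A * d) := by
        have : 1 * 1 < A * d := by nlinarith
        gcongr
      linarith
    calc ((s + d : ℕ) : ℝ) * 3 ^ m ≤ (s + d : ℕ) * 3 ^ (k + s) := by gcongr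
      _ = 3 ^ k * ((s + d) * A) := by push_cast; rw [pow_add]; ring
      _ < 3 ^ k * (s * (A * 3 ^ d - 1)) := by gcongr
      _ = s * (3 ^ (k + (s + d)) - 3 ^ k) := by rw [pow_add, pow_add]; ring

theorem IsSaturated.union_carrier_mem {B : Finset (Finset α)} (hB : IsSaturated B) {Y : Finset α}
    (hY : Y ∈ B) {S : Finset (Finset α)} (hS : ∀ X ∈ S, X ∈ B ∧ (X ∩ Y).Nonempty) :
    Y ∪ carrier S ∈ B := by
  induction S using Finset.induction_on with
  | empty => simpa [carrier] using hY
  | insert X S hXS ih =>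
    have ih := ih fun Z hZ => hS Z (Finset.mem_insert_of_mem hZ)
    obtain ⟨hX, hXY⟩ := hS X (Finset.mem_insert_self _ _)
    have hc : carrier (insert X S) = X ∪ carrier S := Finset.biUnion_insert
    rw [hc, Finset.union_left_comm]
    exact hB X hX _ ih (hXY.mono (Finset.inter_subset_inter_left Finset.subset_union_left))

theorem IsNested.subset_or_disjoint {B N : Finset (Finset α)} (hN : IsNested B N)
    (hB : IsSaturated B) {X Y : Finset α} (hX : X ∈ N) (hY : Y ∈ N) :
    X ⊆ Y ∨ Y ⊆ X ∨ Disjoint X Y := by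
  by_cases h : Disjoint X Y
  · exact Or.inr (Or.inr h)
  rw [Finset.not_disjoint_iff_nonempty_inter] at h
  have hu := hB X (hN.subset hX) Y (hN.subset hY) h
  have hc : carrier {X, Y} = X ∪ Y := by simp [carrier]
  have := hN.carrier_mem {X, Y} (by simp [Finset.insert_subset_iff, hX, hY]) (hc ▸ hu)
  rw [hc, Finset.mem_insert, Finset.mem_singleton, Finset.union_eq_left,
    Finset.union_eq_right] at this
  tauto

/-- For Y in B outside N, compare Y with the smallest member X of N containing it. Y must contain
own elements of X, and the common coordinate there is large enough to make the inequality for Y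
strict. -/
theorem IsNested.exists_point {B N : Finset (Finset α)} (hN : IsNested B N)
    (hB : IsSaturated B) :
    ∃ x : α → ℝ, (∀ X ∈ N, ∑ i ∈ X, x i = 3 ^ X.card) ∧
      ∀ Y ∈ B, Y ∉ N → 3 ^ Y.card < ∑ i ∈ Y, x i := by
  obtain ⟨x, hpos, hx⟩ := exists_tight_point N
    (fun S hS hSN => hN.carrier_mem S hS (hN.subset hSN))
    (fun X hX Y hY => hN.subset_or_disjoint hB hX hY)
  refine ⟨x, fun X hX => (hx X hX).1, fun Y hY hYN => ?_⟩
  obtain ⟨M, hM, hYM⟩ := exists_subset_maximalMembers hY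
  obtain ⟨X, hX, hmin⟩ := Finset.exists_min_image (N.filter (Y ⊆ ·)) Finset.card
    ⟨M, Finset.mem_filter.2 ⟨hN.maximalMembers_subset hM, hYM⟩⟩
  rw [Finset.mem_filter] at hX
  obtain ⟨hX, hYX⟩ := hX
  -- Otherwise the members properly inside `X` that meet `Y` cover `Y`. By saturation their union is
  -- in `B`, so by nestedness it is one of them, contradicting the minimality of `X`.
  have hne : (Y ∩ ownElements N X).Nonempty := by
    by_contra hcon
    rw [Finset.not_nonempty_iff_eq_empty, ← Finset.disjoint_iff_inter_eq_empty] at hcon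
    set S := N.filter fun Z => Z ⊂ X ∧ (Z ∩ Y).Nonempty with hSdef
    have hYS : Y ⊆ carrier S := by
      intro y hy
      have hy' : y ∈ carrier (N.filter (· ⊂ X)) := by
        by_contra hn
        exact Finset.disjoint_left.1 hcon hy (Finset.mem_sdiff.2 ⟨hYX hy, hn⟩)
      obtain ⟨Z, hZ, hyZ⟩ := mem_carrier.1 hy'
      rw [Finset.mem_filter] at hZ
      exact mem_carrier.2 ⟨Z, Finset.mem_filter.2
        ⟨hZ.1, hZ.2, y, Finset.mem_inter.2 ⟨hyZ, hy⟩⟩, hyZ⟩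
    have hmem := hB.union_carrier_mem hY (S := S) fun Z hZ => by
      rw [Finset.mem_filter] at hZ
      exact ⟨hN.subset hZ.1, hZ.2.2⟩
    rw [Finset.union_eq_right.2 hYS] at hmem
    have hmem' := hN.carrier_mem S (Finset.filter_subset _ _) hmem
    rw [hSdef, Finset.mem_filter, ← hSdef] at hmem'
    exact absurd (hmin _ (Finset.mem_filter.2 ⟨hmem'.1, hYS⟩))
      (not_le.2 (Finset.card_lt_card hmem'.2.1))
  obtain ⟨i₀, hi₀⟩ := hne
  have hi₀R := (Finset.mem_inter.1 hi₀).2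
  set R := ownElements N X with hR
  set U := carrier (N.filter (· ⊂ X)) with hU
  have hUX : U ⊆ X := carrier_filter_ssubset_subset N X
  have hcard : U.card + R.card = X.card := by
    rw [hR, ownElements, ← hU, Finset.card_sdiff_of_subset hUX]
    have := Finset.card_le_card hUX
    omega
  have hconst : ∀ T ⊆ R, ∑ i ∈ T, x i = T.card * x i₀ := by
    intro T hT
    rw [Finset.sum_congr rfl fun i hi => (hx X hX).2 i (hT hi) i₀ hi₀R]
    simp
  have hUle : ∑ i ∈ U, x i ≤ 3 ^ U.card :=
    sum_carrier_le (fun i _ => (hpos i).le) fun Z hZ =>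
      (hx Z (Finset.mem_filter.1 hZ).1).1.le
  have hsum := sum_ownElements N X x
  rw [← hR, ← hU, (hx X hX).1, hconst R (Finset.Subset.refl R), ← hcard] at hsum
  have hYle : ∑ i ∈ Y ∩ R, x i ≤ ∑ i ∈ Y, x i :=
    Finset.sum_le_sum_of_subset_of_nonneg Finset.inter_subset_left fun i _ _ => (hpos i).le
  rw [hconst _ Finset.inter_subset_right] at hYle
  refine lt_of_lt_of_le (pow_lt_mul_of_le (k := U.card) (r := R.card) ?_ ?_ ?_ ?_ ?_) hYle
  · exact Finset.card_pos.2 ⟨i₀, hi₀⟩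
  · exact Finset.card_le_card Finset.inter_subset_right
  · have h1 : (Y ∪ R).card ≤ X.card :=
      Finset.card_le_card (Finset.union_subset hYX Finset.sdiff_subset)
    have h2 := Finset.card_union_add_card_inter Y R
    omega
  · rw [hcard]
    exact Finset.card_lt_card (Finset.ssubset_iff_subset_ne.2 ⟨hYX, fun h => hYN (h ▸ hX)⟩)
  · linarith

end Points


/-! ### Faces, vertices and vertex figures of polyhedra -/

section Polyhedra

theorem isSimplex_of_affineIndependent {κ V : Type*} [AddCommGroup V] [Module ℝ V] [Fintype κ]
    {p : κ → V} (hp : AffineIndependent ℝ p) : IsSimplex (convexHull ℝ (Set.range p)) := by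
  refine ⟨Fintype.card κ, p ∘ (Fintype.equivFin κ).symm, ?_, ?_⟩
  · exact hp.comp_embedding (Fintype.equivFin κ).symm.toEmbedding
  · rw [EquivLike.range_comp]

variable {ι E : Type*} [AddCommGroup E] [Module ℝ E] [TopologicalSpace E]

/-- The polyhedron of the inequalities `b X ≤ a X x`, for `X ∈ B`, and the equations
`a X x = b X`, for `X ∈ Q`. -/
def polyhedron (a : ι → StrongDual ℝ E) (b : ι → ℝ) (B Q : Finset ι) : Set E :=
  {x | (∀ X ∈ B, b X ≤ a X x) ∧ ∀ X ∈ Q, a X x = b X}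

/-- The constraints in `B` that hold with equality at `x`. -/
noncomputable def tight (a : ι → StrongDual ℝ E) (b : ι → ℝ) (B : Finset ι) (x : E) : Finset ι :=
  B.filter fun X => a X x = b X

variable {a : ι → StrongDual ℝ E} {b : ι → ℝ} {B Q : Finset ι}

theorem mem_tight {x : E} {X : ι} : X ∈ tight a b B x ↔ X ∈ B ∧ a X x = b X :=
  Finset.mem_filter

theorem subset_tight_iff {x : E} {N : Finset ι} (hN : N ⊆ B) :
    N ⊆ tight a b B x ↔ ∀ X ∈ N, a X x = b X :=
  ⟨fun h X hX => (mem_tight.1 (h hX)).2, fun h X hX => mem_tight.2 ⟨hN hX, h X hX⟩⟩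

theorem convex_polyhedron : Convex ℝ (polyhedron a b B Q) := by
  rintro x ⟨hx, hx'⟩ y ⟨hy, hy'⟩ s t hs ht hst
  refine ⟨fun X hX => ?_, fun X hX => ?_⟩
  · rw [map_add, map_smul, map_smul, smul_eq_mul, smul_eq_mul]
    calc b X = s * b X + t * b X := by rw [← add_mul, hst, one_mul]
      _ ≤ _ := add_le_add (mul_le_mul_of_nonneg_left (hx X hX) hs)
        (mul_le_mul_of_nonneg_left (hy X hX) ht)
  · rw [map_add, map_smul, map_smul, smul_eq_mul, smul_eq_mul, hx' X hX, hy' X hX, ← add_mul, hst,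
      one_mul]

theorem isClosed_polyhedron : IsClosed (polyhedron a b B Q) := by
  have : polyhedron a b B Q = (⋂ X ∈ B, {x | b X ≤ a X x}) ∩ ⋂ X ∈ Q, {x | a X x = b X} := by
    ext x; simp [polyhedron]
  rw [this]
  refine IsClosed.inter (isClosed_biInter fun X _ => ?_) (isClosed_biInter fun X _ => ?_)
  · exact isClosed_le continuous_const (a X).continuous
  · exact isClosed_eq (a X).continuous continuous_const

/-- The segment from y to x can be prolonged beyond x: constraints tight at x are tight at y and
stay tight along the line, and the finitely many others have slack at x. -/
theorem exists_add_smul_sub_mem_polyhedron {x y : E} (hx : x ∈ polyhedron a b B Q)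
    (hy : y ∈ polyhedron a b B Q) (h : tight a b B x ⊆ tight a b B y) :
    ∃ ε : ℝ, 0 < ε ∧ x + ε • (x - y) ∈ polyhedron a b B Q := by
  have hev : ∀ᶠ ε : ℝ in nhdsWithin 0 (Set.Ioi 0), ∀ X ∈ B, b X ≤ a X x + ε * (a X x - a X y) := by
    rw [Filter.eventually_all_finset]
    intro X hX
    by_cases hXt : a X x = b X
    · have hyt := (mem_tight.1 (h (mem_tight.2 ⟨hX, hXt⟩))).2
      simp [hXt, hyt]
    · have hlt : b X < a X x + 0 * (a X x - a X y) := by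
        rw [zero_mul, add_zero]
        exact lt_of_le_of_ne (hx.1 X hX) (Ne.symm hXt)
      have hcont : Continuous fun ε : ℝ => a X x + ε * (a X x - a X y) := by fun_prop
      exact ((hcont.tendsto 0).eventually_const_lt hlt |>.mono fun _ => le_of_lt).filter_mono
        nhdsWithin_le_nhds
  obtain ⟨ε, hε, hpos⟩ := (hev.and self_mem_nhdsWithin).exists
  refine ⟨ε, hpos, fun X hX => ?_, fun X hX => ?_⟩
  · simpa using hε X hX
  · simp [hx.2 X hX, hy.2 X hX]

/-- The points of the polyhedron at which the constraints in `N` hold with equality. -/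
def tightFace (a : ι → StrongDual ℝ E) (b : ι → ℝ) (B Q N : Finset ι) : Set E :=
  {x ∈ polyhedron a b B Q | N ⊆ tight a b B x}

theorem isExposed_tightFace [IsTopologicalAddGroup E] {N : Finset ι} (hN : N ⊆ B) :
    IsExposed ℝ (polyhedron a b B Q) (tightFace a b B Q N) := by
  rintro ⟨x₀, hx₀, hx₀N⟩
  rw [subset_tight_iff hN] at hx₀N
  have hsum : ∀ x, (-∑ X ∈ N, a X) x = -∑ X ∈ N, a X x := fun x => by
    simp
  have hge : ∀ y ∈ polyhedron a b B Q, ∑ X ∈ N, b X ≤ ∑ X ∈ N, a X y := fun y hy =>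
    Finset.sum_le_sum fun X hX => hy.1 X (hN hX)
  refine ⟨-∑ X ∈ N, a X, ?_⟩
  ext x
  simp only [tightFace, Set.mem_ofPred_eq, subset_tight_iff hN, hsum]
  refine and_congr_right fun hx => ⟨fun h y hy => ?_, fun h => ?_⟩
  · rw [Finset.sum_congr rfl h]
    exact neg_le_neg (hge y hy)
  · have h1 := h x₀ hx₀
    rw [Finset.sum_congr rfl hx₀N, neg_le_neg_iff] at h1
    have h2 := (Finset.sum_eq_sum_iff_of_le fun X hX => hx.1 X (hN hX)).1
      (le_antisymm (hge x hx) h1)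
    exact fun X hX => (h2 X hX).symm

/-- The point x, with the fewest tight constraints, plays the role of a relative interior point of
F. A point sharing its tight constraints can be reflected slightly through x, so the exposing
functional cannot be smaller there than at x. -/
theorem exists_eq_tightFace {F : Set E} (hF : IsExposed ℝ (polyhedron a b B Q) F)
    (hne : F.Nonempty) : ∃ x ∈ F, F = tightFace a b B Q (tight a b B x) := by
  obtain ⟨x, hxF, hmin⟩ := (InvImage.wf (fun x => (tight a b B x).card)
    wellFounded_lt).has_min F hne
  refine ⟨x, hxF, ?_⟩
  have hconv := hF.convex convex_polyhedron
  have hsub := hF.subset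
  ext y
  constructor
  · intro hy
    refine ⟨hsub hy, ?_⟩
    -- A constraint tight at the midpoint is tight at both ends. Minimality at `x` then makes the
    -- tight sets of `x` and of the midpoint equal.
    have hz : (1 / 2 : ℝ) • x + (1 / 2 : ℝ) • y ∈ F :=
      hconv hxF hy (by norm_num) (by norm_num) (by norm_num)
    have hzt : ∀ X ∈ tight a b B ((1 / 2 : ℝ) • x + (1 / 2 : ℝ) • y),
        X ∈ tight a b B x ∧ X ∈ tight a b B y := by
      intro X hX
      obtain ⟨hXB, hXt⟩ := mem_tight.1 hX
      have h1 := (hsub hxF).1 X hXB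
      have h2 := (hsub hy).1 X hXB
      simp only [map_add, map_smul, smul_eq_mul] at hXt
      exact ⟨mem_tight.2 ⟨hXB, by linarith⟩, mem_tight.2 ⟨hXB, by linarith⟩⟩
    have heq := Finset.eq_of_subset_of_card_le (fun X hX => (hzt X hX).1)
      (not_lt.1 (hmin _ hz))
    rw [← heq]
    exact fun X hX => (hzt X hX).2
  · rintro ⟨hy, hyt⟩
    obtain ⟨ε, hε, hz⟩ := exists_add_smul_sub_mem_polyhedron (hsub hxF) hy hyt
    obtain ⟨l, hl⟩ := hF hne
    rw [hl] at hxF ⊢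
    have h1 := hxF.2 _ hz
    simp only [map_add, map_smul, map_sub, smul_eq_mul] at h1
    have h2 : l x ≤ l y := by
      by_contra! h
      nlinarith [mul_pos hε (sub_pos.2 h)]
    exact ⟨hy, fun z hz => (hxF.2 z hz).trans h2⟩

theorem tightFace_eq_singleton_of_mem_extremePoints {x : E}
    (hx : x ∈ (polyhedron a b B Q).extremePoints ℝ) :
    tightFace a b B Q (tight a b B x) = {x} := by
  ext y
  constructor
  · rintro ⟨hy, hyt⟩
    obtain ⟨ε, hε, hz⟩ := exists_add_smul_sub_mem_polyhedron hx.1 hy hyt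
    -- `x` lies strictly between `y` and the prolonged point `x + ε • (x - y)`, with weights
    -- proportional to `ε` and 1.
    refine (mem_extremePoints_iff_left.1 hx).2 y hy _ hz
      ⟨ε / (1 + ε), 1 / (1 + ε), by positivity, by positivity, by field_simp; ring, ?_⟩
    have h1 : ε / (1 + ε) = 1 / (1 + ε) * ε := by ring
    rw [h1, mul_smul, ← smul_add]
    have h2 : ε • y + (x + ε • (x - y)) = (1 + ε) • x := by module
    rw [h2, smul_smul, one_div_mul_cancel (by positivity), one_smul]
  · rintro rfl
    exact ⟨hx.1, Finset.Subset.refl _⟩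

theorem finite_extremePoints_polyhedron : ((polyhedron a b B Q).extremePoints ℝ).Finite := by
  refine Set.Finite.of_injOn (f := tight a b B) (t := ↑B.powerset) (fun x _ => ?_)
    (fun x hx y hy hxy => ?_) (Finset.finite_toSet _)
  · exact Finset.mem_powerset.2 (Finset.filter_subset _ _)
  · have : y ∈ tightFace a b B Q (tight a b B x) := ⟨hy.1, hxy ▸ Finset.Subset.refl _⟩
    rw [tightFace_eq_singleton_of_mem_extremePoints hx] at this
    exact (Set.mem_singleton_iff.1 this).symm

theorem isVertex_iff_mem_extremePoints [IsTopologicalAddGroup E] {x : E} :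
    IsVertex (polyhedron a b B Q) x ↔ x ∈ (polyhedron a b B Q).extremePoints ℝ := by
  constructor
  · intro h
    exact isExtreme_singleton.1 (IsExposed.isExtreme h)
  · intro h
    rw [IsVertex, ← tightFace_eq_singleton_of_mem_extremePoints h]
    exact isExposed_tightFace (Finset.filter_subset _ _)

/-- The faces of a polyhedron whose points have as tight sets exactly the members of `𝒩`. -/
theorem nonempty_faces_orderIso [IsTopologicalAddGroup E] {𝒩 : Set (Finset ι)}
    (htight : ∀ x ∈ polyhedron a b B Q, tight a b B x ∈ 𝒩)
    (hpoint : ∀ N ∈ 𝒩, ∃ x ∈ polyhedron a b B Q, tight a b B x = N) :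
    Nonempty (faces (polyhedron a b B Q) ≃o
      ({F : Finset (Option ι) | (∃ N, N ∈ 𝒩 ∧ F = N.map Function.Embedding.some) ∨
        F = Finset.insertNone B} : Set (Finset (Option ι)))ᵒᵈ) := by
  have hsub : ∀ N ∈ 𝒩, N ⊆ B := by
    intro N hN
    obtain ⟨x, -, rfl⟩ := hpoint N hN
    exact Finset.filter_subset _ _
  let 𝒜 : Set (Finset (Option ι)) := {F | (∃ N, N ∈ 𝒩 ∧ F = N.map Function.Embedding.some) ∨
    F = Finset.insertNone B}
  -- A single formula covers both kinds of elements: `none` is never in the image of a tight set, so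
  -- the additional element is sent to the empty face.
  let g : Finset (Option ι) → Set E := fun F =>
    {x ∈ polyhedron a b B Q | F ⊆ (tight a b B x).map Function.Embedding.some}
  have hg₁ : ∀ N, g (N.map Function.Embedding.some) = tightFace a b B Q N := fun N => by
    simp only [g, Finset.map_subset_map, tightFace]
  have hg₂ : g (Finset.insertNone B) = ∅ := by
    rw [Set.eq_empty_iff_forall_notMem]
    rintro x ⟨-, hx⟩
    have := hx (Finset.none_mem_insertNone)
    simp at this
  have hface : ∀ F ∈ 𝒜, g F ∈ faces (polyhedron a b B Q) := by
    rintro F (⟨N, hN, rfl⟩ | rfl)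
    · rw [hg₁]
      exact isExposed_tightFace (hsub N hN)
    · rw [hg₂]
      exact isExposed_empty
  have hle : ∀ F ∈ 𝒜, ∀ G ∈ 𝒜, g F ⊆ g G ↔ G ⊆ F := by
    intro F hF G hG
    refine ⟨fun h => ?_, fun h x hx => ⟨hx.1, h.trans hx.2⟩⟩
    rcases hF with ⟨N, hN, rfl⟩ | rfl
    -- A point whose tight set is exactly `N` shows that an inclusion of faces forces the reverse
    -- inclusion of families.
    · obtain ⟨x, hx, rfl⟩ := hpoint N hN
      exact (h ⟨hx, Finset.Subset.refl _⟩).2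
    · rcases hG with ⟨N, hN, rfl⟩ | rfl
      · intro o ho
        obtain ⟨X, hX, rfl⟩ := Finset.mem_map.1 ho
        exact Finset.some_mem_insertNone.2 (hsub N hN hX)
      · exact Finset.Subset.refl _
  let f : 𝒜ᵒᵈ ↪o faces (polyhedron a b B Q) :=
    OrderEmbedding.ofMapLEIff (fun F => ⟨g (OrderDual.ofDual F).1, hface _ (OrderDual.ofDual F).2⟩)
      fun F G => hle _ (OrderDual.ofDual F).2 _ (OrderDual.ofDual G).2
  refine ⟨(RelIso.ofSurjective f ?_).symm⟩
  rintro ⟨F, hF⟩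
  rcases F.eq_empty_or_nonempty with rfl | hne
  · exact ⟨OrderDual.toDual ⟨_, Or.inr rfl⟩, Subtype.ext hg₂⟩
  · obtain ⟨x, hx, hFx⟩ := exists_eq_tightFace hF hne
    refine ⟨OrderDual.toDual ⟨_, Or.inl ⟨_, htight x (hF.subset hx), rfl⟩⟩, Subtype.ext ?_⟩
    exact (hg₁ _).trans hFx.symm

theorem tightFace_eq_singleton_of_injective {K : Finset ι} {v : E} (hK : K ⊆ B)
    (hker : ∀ d, (∀ X ∈ K, a X d = 0) → d = 0) (hv : v ∈ tightFace a b B Q K) :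
    tightFace a b B Q K = {v} := by
  ext y
  refine ⟨fun hy => ?_, fun hy => hy ▸ hv⟩
  have h1 := (subset_tight_iff hK).1 hv.2
  have h2 := (subset_tight_iff hK).1 hy.2
  exact sub_eq_zero.1 (hker _ fun X hX => by rw [map_sub, h1 X hX, h2 X hX, sub_self])

section Topology

variable [IsTopologicalAddGroup E] [ContinuousSMul ℝ E] [T2Space E] [LocallyConvexSpace ℝ E]

theorem polyhedron_eq_convexHull (hc : IsCompact (polyhedron a b B Q)) :
    polyhedron a b B Q = convexHull ℝ ((polyhedron a b B Q).extremePoints ℝ) := by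
  rw [← (finite_extremePoints_polyhedron.isClosed_convexHull ℝ).closure_eq,
    closure_convexHull_extremePoints hc convex_polyhedron]

/-- By Krein–Milman a compact face whose only possible extreme point is v reduces to v, and extreme
points of a face are extreme in the whole polyhedron. -/
theorem exists_isVertex_mem_ne {N : Finset ι} (hN : N ⊆ B) (hc : IsCompact (polyhedron a b B Q))
    {v q : E} (hq : q ∈ tightFace a b B Q N) (hqv : q ≠ v) :
    ∃ w, IsVertex (polyhedron a b B Q) w ∧ w ≠ v ∧ w ∈ tightFace a b B Q N := by
  have hexp : IsExposed ℝ (polyhedron a b B Q) (tightFace a b B Q N) := isExposed_tightFace hN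
  by_contra! hcon
  have hsub : (tightFace a b B Q N).extremePoints ℝ ⊆ {v} := by
    intro w hw
    by_contra hwv
    exact hcon w (isVertex_iff_mem_extremePoints.2
      (hexp.isExtreme.extremePoints_subset_extremePoints hw)) hwv hw.1
  have hcl := closure_convexHull_extremePoints (hexp.isCompact hc) (hexp.convex convex_polyhedron)
  rw [← hcl] at hq
  have := closure_mono (convexHull_mono hsub) hq
  rw [convexHull_singleton, closure_singleton] at this
  exact hqv this

/-- Releasing one tight inequality X gives a second vertex w on the face of the others, and the
segment from v to w meets the section in a point p. At p only X has slack among the constraints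
tight at v, so these functionals serve as dual coordinates for the points p. -/
theorem isSimplex_of_isVertexFigure [DecidableEq ι] {v : E} {F : Set E}
    (hc : IsCompact (polyhedron a b B Q)) (hv : v ∈ polyhedron a b B Q)
    (hker : ∀ d, (∀ X ∈ tight a b B v, a X d = 0) → d = 0)
    (hpoint : ∀ X ∈ tight a b B v, X ∉ Q →
      ∃ x ∈ polyhedron a b B Q, tight a b B x = (tight a b B v).erase X)
    (hF : IsVertexFigure (polyhedron a b B Q) v F) : IsSimplex F := by
  obtain ⟨l, c, hcv, hother, rfl⟩ := hF
  have hKB : tight a b B v ⊆ B := Finset.filter_subset _ _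
  have hw : ∀ X : {X // X ∈ tight a b B v \ Q}, ∃ w ∈ polyhedron a b B Q, l w < c ∧
      b X < a X w ∧ ∀ Z ∈ tight a b B v, Z ≠ X.1 → a Z w = b Z := by
    rintro ⟨X, hX⟩
    rw [Finset.mem_sdiff] at hX
    obtain ⟨q, hq, hqt⟩ := hpoint X hX.1 hX.2
    have hqv : q ≠ v := by
      rintro rfl
      exact Finset.notMem_erase X _ (hqt ▸ hX.1)
    have hsub : (tight a b B v).erase X ⊆ B := (Finset.erase_subset _ _).trans hKB
    obtain ⟨w, hwv, hne, hwP, hwt⟩ := exists_isVertex_mem_ne hsub hc ⟨hq, hqt.ge⟩ hqv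
    rw [subset_tight_iff hsub] at hwt
    refine ⟨w, hwP, hother w hwv hne, lt_of_le_of_ne (hwP.1 X (hKB hX.1)) fun heq => hne ?_,
      fun Z hZ hZX => hwt Z (Finset.mem_erase.2 ⟨hZX, hZ⟩)⟩
    refine sub_eq_zero.1 (hker _ fun Z hZ => ?_)
    rw [map_sub, (mem_tight.1 hZ).2, sub_eq_zero]
    by_cases hZX : Z = X
    · rw [hZX, heq]
    · exact hwt Z (Finset.mem_erase.2 ⟨hZX, hZ⟩)
  choose w hwP hwl hwX hwZ using hw
  -- The parameter at which the segment from `v` to `w X` crosses the hyperplane `l = c`.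
  set θ : {X // X ∈ tight a b B v \ Q} → ℝ := fun X => (l v - c) / (l v - l (w X)) with hθ
  have hden : ∀ X, 0 < l v - l (w X) := fun X => by linarith [hwl X]
  have hθpos : ∀ X, 0 < θ X := fun X => div_pos (by linarith) (hden X)
  have hθle : ∀ X, θ X ≤ 1 := fun X => (div_le_one (hden X)).2 (by linarith [hwl X])
  have hθl : ∀ X, θ X * (l (w X) - l v) = c - l v := fun X => by
    have := (hden X).ne'
    simp only [hθ]
    field_simp
    ring
  set p : {X // X ∈ tight a b B v \ Q} → E := fun X => v + θ X • (w X - v) with hp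
  have hpP : ∀ X, p X ∈ polyhedron a b B Q := fun X =>
    convex_polyhedron.add_smul_sub_mem hv (hwP X) ⟨(hθpos X).le, hθle X⟩
  have hpl : ∀ X, l (p X) = c := fun X => by
    simp only [hp, map_add, map_smul, map_sub, smul_eq_mul, hθl]
    ring
  have htv : ∀ X : {X // X ∈ tight a b B v \ Q}, a X v = b X := fun X =>
    (mem_tight.1 (Finset.mem_sdiff.1 X.2).1).2
  have hpX : ∀ X : {X // X ∈ tight a b B v \ Q}, b X < a X (p X) := fun X => by
    simp only [hp, map_add, map_smul, map_sub, smul_eq_mul, htv]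
    have := mul_pos (hθpos X) (sub_pos.2 (hwX X))
    linarith
  have hpZ : ∀ X, ∀ Z ∈ tight a b B v, Z ≠ X.1 → a Z (p X) = b Z := fun X Z hZ hZX => by
    simp [hp, (mem_tight.1 hZ).2, hwZ X Z hZ hZX]
  have hind : AffineIndependent ℝ p := by
    rw [affineIndependent_iff]
    intro s μ hμ hμp X hX
    have h1 := congrArg (a X) hμp
    rw [map_sum, map_zero] at h1
    have h2 : ∑ Y ∈ s, μ Y * (a X (p Y) - b X) = 0 := by
      simp only [mul_sub, Finset.sum_sub_distrib, ← Finset.sum_mul, hμ, zero_mul, sub_zero]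
      simpa using h1
    rw [Finset.sum_eq_single_of_mem X hX fun Y _ hYX => by
      rw [hpZ Y X (Finset.mem_sdiff.1 X.2).1 fun h => hYX (Subtype.ext h.symm), sub_self,
        mul_zero]] at h2
    exact (mul_eq_zero.1 h2).resolve_right (sub_pos.2 (hpX X)).ne'
  have hFeq : {x ∈ polyhedron a b B Q | l x = c} = convexHull ℝ (Set.range p) := by
    apply Set.Subset.antisymm
    · rintro y ⟨hy, hyl⟩
      -- Evaluating `a X` on a combination of the `p Y` leaves only the slack of `p X`, so the
      -- coefficients of `y` are forced to be these ratios.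
      set μ : {X // X ∈ tight a b B v \ Q} → ℝ := fun X =>
        (a X y - b X) / (a X (p X) - b X) with hμ
      have hμ0 : ∀ X, 0 ≤ μ X := fun X =>
        div_nonneg (sub_nonneg.2 (hy.1 X (hKB (Finset.mem_sdiff.1 X.2).1)))
          (sub_pos.2 (hpX X)).le
      have hzero : y - v - ∑ X, μ X • (p X - v) = 0 := by
        refine hker _ fun Z hZ => ?_
        have hZv := (mem_tight.1 hZ).2
        rw [map_sub, map_sub, map_sum, hZv]
        simp only [map_smul, map_sub, hZv, smul_eq_mul]
        by_cases hZQ : Z ∈ Q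
        · rw [hy.2 Z hZQ, Finset.sum_eq_zero fun X _ => by rw [(hpP X).2 Z hZQ, sub_self, mul_zero]]
          simp
        · rw [Finset.sum_eq_single (⟨Z, Finset.mem_sdiff.2 ⟨hZ, hZQ⟩⟩ : {X // X ∈ tight a b B v \ Q})]
          · have := (sub_pos.2 (hpX ⟨Z, Finset.mem_sdiff.2 ⟨hZ, hZQ⟩⟩)).ne'
            simp only [hμ]
            rw [div_mul_cancel₀ _ this, sub_self]
          · intro X _ hXZ
            rw [hpZ X Z hZ fun h => hXZ (Subtype.ext h.symm), sub_self, mul_zero]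
          · simp
      -- Since `l` equals `c` at `y` and at every `p X`, applying it to the identity gives `(1 - ∑
      -- μ) (c - l v) = 0`, where `c - l v` is nonzero.
      have hμ1 : ∑ X, μ X = 1 := by
        have h1 := congrArg l hzero
        simp only [map_sub, map_sum, map_smul, map_zero, smul_eq_mul, hpl, hyl,
          ← Finset.sum_mul] at h1
        have h2 : (1 - ∑ X, μ X) * (c - l v) = 0 := by linarith
        have h3 := (mul_eq_zero.1 h2).resolve_right (by linarith)
        linarith
      have hysum : y = ∑ X, μ X • p X := by
        simp only [smul_sub, Finset.sum_sub_distrib, ← Finset.sum_smul, hμ1, one_smul] at hzero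
        rw [sub_sub_sub_cancel_right] at hzero
        exact sub_eq_zero.1 hzero
      rw [hysum]
      exact (convex_convexHull ℝ _).sum_mem (fun X _ => hμ0 X) hμ1
        fun X _ => subset_convexHull ℝ _ (Set.mem_range_self X)
    · refine convexHull_min ?_ (convex_polyhedron.inter
        (convex_hyperplane l.toLinearMap.isLinear c))
      rintro _ ⟨X, rfl⟩
      exact ⟨hpP X, hpl X⟩
  rw [hFeq]
  exact isSimplex_of_affineIndependent hind

end Topology

end Polyhedra


/-! ### The realization as a polyhedron -/

section RealizationProof

variable {α : Type*} [DecidableEq α]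

theorem sum_subtype_filter_eq {C X : Finset α} (hX : X ⊆ C) {y : {i // i ∈ C} → ℝ} {x : α → ℝ}
    (h : ∀ i, x i.1 = y i) : ∑ i : {i // i ∈ C} with i.1 ∈ X, y i = ∑ i ∈ X, x i := by
  refine Finset.sum_bij (fun i _ => i.1) (fun i hi => (Finset.mem_filter.1 hi).2)
    (fun _ _ _ _ hij => Subtype.ext hij) (fun i hi => ?_) (fun i _ => (h i).symm)
  exact ⟨⟨i, hX hi⟩, by simpa using hi, rfl⟩

/-- The linear functional `x ↦ ∑_{i ∈ X} x_i` on `ℝ^(⋃ H)`. -/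
noncomputable def sumFunctional (H : Finset (Finset α)) (X : Finset α) : StrongDual ℝ (Space H) :=
  ∑ i : {i // i ∈ carrier H} with i.1 ∈ X, ContinuousLinearMap.proj i

theorem sumFunctional_apply (H : Finset (Finset α)) (X : Finset α) (x : Space H) :
    sumFunctional H X x = ∑ i : {i // i ∈ carrier H} with i.1 ∈ X, x i := by
  simp [sumFunctional]

/-- The extension of a point of `ℝ^(⋃ H)` by zero. -/
def extendZero {H : Finset (Finset α)} (x : Space H) (i : α) : ℝ :=
  if h : i ∈ carrier H then x ⟨i, h⟩ else 0

theorem extendZero_coe {H : Finset (Finset α)} (x : Space H) (i : {i // i ∈ carrier H}) :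
    extendZero x i.1 = x i := dif_pos i.2

theorem sumFunctional_eq_sum {H : Finset (Finset α)} {X : Finset α} (hX : X ⊆ carrier H)
    {y : Space H} {x : α → ℝ} (h : ∀ i, x i.1 = y i) : sumFunctional H X y = ∑ i ∈ X, x i := by
  rw [sumFunctional_apply, sum_subtype_filter_eq hX h]

/-- The realization of `H` as the solution set of all its constraints. -/
def constraintPolytope (H : Finset (Finset α)) : Set (Space H) :=
  polyhedron (sumFunctional H) (fun X => (3 : ℝ) ^ X.card) (satClosure H)
    (maximalMembers (satClosure H))

/-- The members of the saturated closure whose constraints are tight at `x`. -/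
noncomputable def tightSets (H : Finset (Finset α)) (x : Space H) : Finset (Finset α) :=
  tight (sumFunctional H) (fun X => (3 : ℝ) ^ X.card) (satClosure H) x

theorem isComponent_satClosure_iff {H J : Finset (Finset α)} (hH : IsHypergraph H)
    (hA : IsAtomic H) : IsComponent (satClosure H) J ↔
      ∃ M ∈ maximalMembers (satClosure H), J = restrict (satClosure H) M := by
  have hB := isHypergraph_satClosure hH hA
  have hBA := isAtomic_satClosure hA
  rw [isComponent_iff hB hBA, (isSaturated_satClosure hH hA).satClosure_eq hB hBA]

theorem ascPolytope_eq {H : Finset (Finset α)} (hc : carrier H ∈ H) :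
    ascPolytope H = polyhedron (sumFunctional H) (fun X => (3 : ℝ) ^ X.card) H {carrier H} := by
  ext x
  simp only [ascPolytope, polyhedron, halfspace, hyperplane, Set.mem_inter_iff, Set.mem_iInter,
    Set.mem_ofPred_eq, Finset.mem_erase, Finset.mem_singleton, forall_eq, sumFunctional_apply]
  refine and_congr_left fun heq => ⟨fun h X hX => ?_, fun h X hX => h X hX.2⟩
  by_cases hXc : X = carrier H
  · rw [hXc, heq]
  · exact h X ⟨hXc, hX⟩

/-- Each member of the closure lies inside a maximal one, so the constraints of the separate
components together are those of the whole closure. Coordinate sums do not depend on the ambient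
space. -/
theorem polytope_eq {H : Finset (Finset α)} (hH : IsHypergraph H) (hA : IsAtomic H) :
    polytope H = constraintPolytope H := by
  have hcr : ∀ M ∈ maximalMembers (satClosure H), carrier (restrict (satClosure H) M) = M := by
    intro M hM
    refine (isAtomic_satClosure hA).carrier_restrict ?_
    rw [carrier_satClosure]
    exact subset_carrier_of_mem_maximalMembers hM
  have hmem : ∀ M ∈ maximalMembers (satClosure H), M ∈ restrict (satClosure H) M := fun M hM =>
    mem_restrict.2 ⟨(mem_maximalMembers.1 hM).1, Finset.Subset.refl _⟩
  have key : ∀ (x : Space H) (J : Finset (Finset α)) (hJ : IsComponent (satClosure H) J)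
      (X : Finset α), X ∈ J →
      sumFunctional J X (fun i : {i // i ∈ carrier J} => x ⟨i, hJ.mem_carrier i.2⟩) =
        sumFunctional H X x := by
    intro x J hJ X hX
    have hXJ := subset_carrier hX
    rw [sumFunctional_eq_sum (x := extendZero x) (hXJ.trans fun i hi => hJ.mem_carrier hi)
      (extendZero_coe x), sumFunctional_eq_sum hXJ]
    exact fun i => extendZero_coe x ⟨i.1, hJ.mem_carrier i.2⟩
  ext x
  constructor
  · intro hx
    have hx' : ∀ M ∈ maximalMembers (satClosure H),
        (∀ X ∈ restrict (satClosure H) M, (3 : ℝ) ^ X.card ≤ sumFunctional H X x) ∧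
          sumFunctional H M x = 3 ^ M.card := by
      intro M hM
      have hJ := (isComponent_satClosure_iff hH hA).2 ⟨M, hM, rfl⟩
      have h := hx _ hJ
      rw [ascPolytope_eq ((hcr M hM).symm ▸ hmem M hM)] at h
      refine ⟨fun X hX => ?_, ?_⟩
      · rw [← key x _ hJ X hX]
        exact h.1 X hX
      · rw [← key x _ hJ M (hmem M hM)]
        exact h.2 M (by rw [hcr M hM]; exact Finset.mem_singleton_self _)
    refine ⟨fun X hX => ?_, fun M hM => (hx' M hM).2⟩
    obtain ⟨M, hM, hXM⟩ := exists_subset_maximalMembers hX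
    exact (hx' M hM).1 X (mem_restrict.2 ⟨hX, hXM⟩)
  · rintro hx J hJ
    obtain ⟨M, hM, rfl⟩ := (isComponent_satClosure_iff hH hA).1 hJ
    rw [ascPolytope_eq ((hcr M hM).symm ▸ hmem M hM)]
    refine ⟨fun X hX => ?_, fun X hX => ?_⟩
    · rw [key x _ hJ X hX]
      exact hx.1 X (mem_restrict.1 hX).1
    · rw [Finset.mem_singleton, hcr M hM] at hX
      subst hX
      rw [key x _ hJ _ (hmem _ hM)]
      exact hx.2 _ hM

theorem polytope_eq_ascPolytope {H : Finset (Finset α)} (hH : IsHypergraph H) (hA : IsAtomic H)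
    (hne : H.Nonempty) (hS : IsSaturated H) (hc : IsConnected H) :
    polytope H = ascPolytope H := by
  obtain ⟨X, hX⟩ := hne
  have hCne := (hH.nonempty hX).mono (subset_carrier hX)
  have hC := carrier_mem_satClosure hH hA hc hCne
  rw [hS.satClosure_eq hH hA] at hC
  rw [polytope_eq hH hA, constraintPolytope,
    maximalMembers_satClosure_of_isConnected hH hA hc hCne, hS.satClosure_eq hH hA,
    ascPolytope_eq hC]

theorem extendZero_nonneg {H : Finset (Finset α)} {x : Space H} (hA : IsAtomic H)
    (hx : x ∈ constraintPolytope H) (i : α) : 0 ≤ extendZero x i := by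
  by_cases hi : i ∈ carrier H
  · have := hx.1 {i} (subset_satClosure H (hA i hi))
    rw [sumFunctional_eq_sum (by simpa using hi) (extendZero_coe x)] at this
    simp only [Finset.card_singleton, pow_one, Finset.sum_singleton] at this
    linarith
  · rw [extendZero, dif_neg hi]

theorem isCompact_constraintPolytope {H : Finset (Finset α)} (hA : IsAtomic H) :
    IsCompact (constraintPolytope H) := by
  -- Coordinates are nonnegative, and each is bounded by the total of its component.
  refine IsCompact.of_isClosed_subset
    (isCompact_Icc (a := (fun _ => 0 : Space H)) (b := fun _ => (3 : ℝ) ^ (carrier H).card))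
    isClosed_polyhedron fun x hx => ?_
  have hnn := extendZero_nonneg hA hx
  refine ⟨fun i => extendZero_coe x i ▸ hnn i, fun i => ?_⟩
  obtain ⟨M, hM, hiM⟩ := exists_subset_maximalMembers (subset_satClosure H (hA i.1 i.2))
  have hMC := subset_carrier_of_mem_maximalMembers hM
  have h1 := hx.2 M hM
  rw [sumFunctional_eq_sum hMC (extendZero_coe x)] at h1
  have h2 := Finset.single_le_sum (f := extendZero x) (fun j _ => hnn j)
    (hiM (Finset.mem_singleton_self i.1))
  rw [h1, extendZero_coe] at h2
  exact h2.trans (pow_le_pow_right₀ (by norm_num) (Finset.card_le_card hMC))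

theorem isNested_tightSets {H : Finset (Finset α)} (hA : IsAtomic H) {x : Space H}
    (hx : x ∈ constraintPolytope H) : IsNested (satClosure H) (tightSets H x) := by
  refine ⟨Finset.filter_subset _ _, fun M hM =>
    mem_tight.2 ⟨(mem_maximalMembers.1 hM).1, hx.2 M hM⟩, fun S hS hSB => ?_⟩
  refine (carrier_mem_or_sum_lt (x := extendZero x) (fun i _ => extendZero_nonneg hA hx i)
    fun X hX => ?_).resolve_right ?_
  · obtain ⟨hXB, hXt⟩ := mem_tight.1 (hS hX)
    rw [sumFunctional_eq_sum (subset_carrier_of_mem_satClosure hXB) (extendZero_coe x)] at hXt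
    exact hXt.le
  · rw [← sumFunctional_eq_sum (subset_carrier_of_mem_satClosure hSB) (extendZero_coe x)]
    exact not_lt.2 (hx.1 _ hSB)

theorem IsNested.exists_tightSets_eq {H N : Finset (Finset α)} (hN : IsNested (satClosure H) N)
    (hH : IsHypergraph H) (hA : IsAtomic H) : ∃ x ∈ constraintPolytope H, tightSets H x = N := by
  obtain ⟨x, hx, hx'⟩ := hN.exists_point (isSaturated_satClosure hH hA)
  have hs : ∀ X ∈ satClosure H, sumFunctional H X (fun i => x i.1) = ∑ i ∈ X, x i := fun X hX =>
    sumFunctional_eq_sum (subset_carrier_of_mem_satClosure hX) fun _ => rfl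
  refine ⟨fun i => x i.1, ⟨fun X hX => ?_, fun M hM => ?_⟩, ?_⟩
  · rw [hs X hX]
    by_cases hXN : X ∈ N
    · exact (hx X hXN).ge
    · exact (hx' X hX hXN).le
  · rw [hs M (mem_maximalMembers.1 hM).1]
    exact hx M (hN.maximalMembers_subset hM)
  · ext X
    rw [tightSets, mem_tight]
    constructor
    · rintro ⟨hXB, hXt⟩
      rw [hs X hXB] at hXt
      by_contra hXN
      exact (hx' X hXB hXN).ne' hXt
    · intro hXN
      rw [hs X (hN.subset hXN)]
      exact ⟨hN.subset hXN, hx X hXN⟩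

theorem IsConstruction.eq_zero_of_sumFunctional {H K : Finset (Finset α)}
    (hK : IsConstruction H K) (hH : IsHypergraph H) (hA : IsAtomic H) (d : Space H)
    (hd : ∀ X ∈ K, sumFunctional H X d = 0) : d = 0 := by
  have h := hK.eq_zero hA (d := extendZero d) fun X hX => by
    rw [← sumFunctional_eq_sum (subset_carrier_of_mem_satClosure ((hK.isNested hH hA).subset hX))
      (extendZero_coe d), hd X hX]
  ext i
  rw [← extendZero_coe d i, h i.1 i.2]
  rfl

theorem IsConstruction.isVertex {H : Finset (Finset α)} {x : Space H}
    (hK : IsConstruction H (tightSets H x)) (hH : IsHypergraph H) (hA : IsAtomic H)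
    (hx : x ∈ constraintPolytope H) : IsVertex (constraintPolytope H) x := by
  have hB : tightSets H x ⊆ satClosure H := Finset.filter_subset _ _
  rw [IsVertex, ← tightFace_eq_singleton_of_injective hB (hK.eq_zero_of_sumFunctional hH hA)
    ⟨hx, Finset.Subset.refl _⟩]
  exact isExposed_tightFace hB

theorem eq_of_isVertex {H : Finset (Finset α)} {v x : Space H}
    (hv : IsVertex (constraintPolytope H) v) (hx : x ∈ constraintPolytope H)
    (h : tightSets H v ⊆ tightSets H x) : x = v := by
  have h1 := tightFace_eq_singleton_of_mem_extremePoints (isVertex_iff_mem_extremePoints.1 hv)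
  exact Set.mem_singleton_iff.1 (h1 ▸ ⟨hx, h⟩)

/-- The tight family of a vertex v extends to a construction, which is the exact tight family of
some point. That point lies on the smallest face through v, so it is v, and nothing was added. -/
theorem isConstruction_tightSets {H : Finset (Finset α)} (hH : IsHypergraph H) (hA : IsAtomic H)
    {v : Space H} (hv : IsVertex (constraintPolytope H) v) :
    IsConstruction H (tightSets H v) := by
  have hvP : v ∈ constraintPolytope H := IsExposed.subset hv rfl
  obtain ⟨K, hK, hsub⟩ := (isNested_tightSets hA hvP).exists_isConstruction hH hA
  obtain ⟨x, hx, rfl⟩ := (hK.isNested hH hA).exists_tightSets_eq hH hA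
  rwa [eq_of_isVertex hv hx hsub] at hK

end RealizationProof

end HGraph

theorem proposition9p10 {α : Type*} [DecidableEq α] (H : Finset (Finset α))
    (hH : HGraph.IsHypergraph H) (hA : HGraph.IsAtomic H) :
    HGraph.IsConvexPolytope (HGraph.polytope H) ∧
    Nonempty (HGraph.faces (HGraph.polytope H) ≃o HGraph.AbstractPolytope H) ∧
    (H.Nonempty → HGraph.IsSaturated H → HGraph.IsConnected H →
      HGraph.polytope H = HGraph.ascPolytope H) ∧
    HGraph.IsSimplePolytope (HGraph.polytope H) ∧
    (∃ e : {v // HGraph.IsVertex (HGraph.polytope H) v} ≃ {K // HGraph.IsConstruction H K},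
      ∀ v, (⋂ X ∈ (e v).1, HGraph.hyperplane H X) = {v.1} ∧
        ∀ Y ∈ HGraph.satClosure H \ (e v).1, v.1 ∉ HGraph.hyperplane H Y) := by
  open HGraph in
  refine ⟨?_, ?_, polytope_eq_ascPolytope hH hA, ?_⟩ <;> rw [polytope_eq hH hA]
  · exact ⟨_, finite_extremePoints_polyhedron,
      polyhedron_eq_convexHull (isCompact_constraintPolytope hA)⟩
  · have hset : abstractFaces H = {F | (∃ N, N ∈ {N | IsNested (satClosure H) N} ∧
        F = N.map Function.Embedding.some) ∨ F = Finset.insertNone (satClosure H)} := by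
      simp only [abstractFaces, isConstruct_iff_isNested hH hA, Set.mem_ofPred_eq]
    change Nonempty (_ ≃o (abstractFaces H)ᵒᵈ)
    rw [hset]
    exact nonempty_faces_orderIso (fun x hx => isNested_tightSets hA hx)
      fun N hN => IsNested.exists_tightSets_eq hN hH hA
  · refine ⟨⟨⟨_, finite_extremePoints_polyhedron,
      polyhedron_eq_convexHull (isCompact_constraintPolytope hA)⟩, fun v hv F hF => ?_⟩, ?_⟩
    · have hvP : v ∈ constraintPolytope H := IsExposed.subset hv rfl
      refine isSimplex_of_isVertexFigure (isCompact_constraintPolytope hA) hvP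
        ((isConstruction_tightSets hH hA hv).eq_zero_of_sumFunctional hH hA)
        (fun X _ hXQ => ?_) hF
      have hN := isNested_tightSets hA hvP
      -- Simplicity: erasing any nonmaximal member preserves nestedness, so the smaller family is
      -- again the exact tight family of a point.
      exact (hN.mono (Finset.erase_subset X _) fun M hM => Finset.mem_erase.2
        ⟨fun h => hXQ (h ▸ hM), hN.maximalMembers_subset hM⟩).exists_tightSets_eq hH hA
    · refine ⟨Equiv.ofBijective (fun v => ⟨tightSets H v.1, isConstruction_tightSets hH hA v.2⟩)
        ⟨fun v w hvw => ?_, fun ⟨K, hK⟩ => ?_⟩, fun v => ⟨?_, fun Y hY hvY => ?_⟩⟩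
      · have hle : tightSets H w.1 ⊆ tightSets H v.1 := (congrArg Subtype.val hvw).ge
        exact Subtype.ext (eq_of_isVertex w.2 (IsExposed.subset v.2 rfl) hle)
      · obtain ⟨x, hx, rfl⟩ := (hK.isNested hH hA).exists_tightSets_eq hH hA
        exact ⟨⟨x, hK.isVertex hH hA hx⟩, rfl⟩
      · ext x
        simp only [Set.mem_iInter, Set.mem_singleton_iff, hyperplane,
          Set.mem_ofPred_eq, ← sumFunctional_apply]
        constructor
        -- The difference from `v` lies in the common kernel of the functionals of the construction,
        -- which is trivial; membership of `x` in the polytope is not needed.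
        · intro hx
          refine sub_eq_zero.1 ((isConstruction_tightSets hH hA v.2).eq_zero_of_sumFunctional hH hA
            _ fun X hX => ?_)
          rw [map_sub, hx X hX, (mem_tight.1 hX).2, sub_self]
        · rintro rfl X hX
          exact (mem_tight.1 hX).2
      · rw [Finset.mem_sdiff] at hY
        refine hY.2 (mem_tight.2 ⟨hY.1, ?_⟩)
        rw [sumFunctional_apply]
        exact hvY
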